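/- **Setting.** Let $M\ge 0$, $N\ge 1$ be integers; $\rho_c,\rho_s,\rho_{\rm SI},\eta,\lambda,d_0,\mu>0$ and $w\in[0,1]$ be reals. Two transceivers $k\in\{A,B\}$ (write $k'$ for the other one) operate in two half-intervals $i\in\{1,2\}$; they have target angles $\theta_k\in\mathbb R$, reflection coefficients $\alpha_k\in\mathbb C$, channels $\mathbf h_k\in\mathbb C^M$ (from $k$ to $k'$) and self-interference channels $\mathbf g_k\in\mathbb C^M$. Let $\mathbf a(\theta)=\big(e^{j\frac{2\pi}{\lambda}md_0\sin\theta}\big)_{m=0}^{M-1}$ and $\dot{\mathbf a}=\partial\mathbf a/\partial\theta$. For $\mathbf w_{k,i}\in\mathbb C^M$ and Hermitian $\mathbf Q_{k,i}\in\mathbb C^{M\times M}$ put $$\Phi_{k,i}=\eta\,\mathbf g_k^H\mathbf Q_{k,i}\mathbf g_k,\quad B_{k,i}=\rho_{\rm SI}\Phi_{k,i}+1,\quad I_{k,i}=\rho_s\mathbf a^H(\theta_k)\mathbf Q_{k,i}\mathbf a(\theta_k)+B_{k,i},$$ $$\gamma_{k,i}=\frac{\rho_c|\mathbf h_{k'}^H\mathbf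 w_{k',i}|^2}{I_{k,i}},\quad G_{k,i}=|\alpha_k|^2\,\dot{\mathbf a}^H(\theta_k)\mathbf Q_{k,i}\dot{\mathbf a}(\theta_k),$$ $$R=\sum_k\tfrac12\sum_{i}\log_2(1+\gamma_{k,i}),\qquad C=\sum_k\frac1{2\rho_sN}\Big(\sum_i\frac{G_{k,i}}{B_{k,i}}\Big)^{-1}.$$ **Problem (P).** Maximize $wR-(1-w)\mu C$ (read as $R$ when $w=1$) over $\{\mathbf w_{k,i},\mathbf Q_{k,i}\}$ subject to $\sum_i\mathrm{tr}(\mathbf Q_{k,i})\le2$ for all $k$, $\mathbf Q_{k,i}\succeq\mathbf w_{k,i}\mathbf w_{k,i}^H$ for all $k,i$, and the mode constraint: either full-duplex, $\mathbf Q_{k,1}=\mathbf Q_{k,2}$ for both $k$; or half-duplex, $\mathbf Q_{A,2}=\mathbf Q_{B,1}=\mathbf 0$. **Algorithm.** Start at $\{\mathbf w^{[0]}_{k,i},\mathbf Q^{[0]}_{k,i},g^{[0]}_{k,i}\}$ with $(\mathbf w^{[0]},\mathbf Q^{[0]})$ feasible for (P), $(g^{[0]}_{k,i})^2\le G^{[0]}_{k,i}$,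 $g^{[0]}_{k,i}\ge0$, and $g^{[0]}_{k,i}>0$ whenever $k$ transmits in interval $i$ (always in full-duplex mode; only for $(A,1)$ and $(B,2)$ in half-duplex mode). For every $t\ge0$ let $\{\mathbf w^{[t+1]},\mathbf Q^{[t+1]},g^{[t+1]}\}$ be the corresponding part of a global maximizer of the convex problem $$\max_{\mathbf w,\mathbf Q,r,g,d}\ \frac w2\sum_{k,i}\log_2(1+r_{k,i})-\frac{(1-w)\mu}{2\rho_sN}\sum_k\Big(\sum_id_{k,i}\Big)^{-1}$$ subject to, for all $k,i$, $r_{k,i}\ge0$; $g_{k,i},d_{k,i}\ge0$, with strict inequality whenever $k$ transmits in interval $i$; $G_{k,i}\ge g_{k,i}^2$; $$\frac{2\rho_c\,\mathrm{Re}\{(\mathbf w^{[t]}_{k',i})^H\mathbf h_{k'}\mathbf h_{k'}^H\mathbf w_{k',i}\}}{I^{[t]}_{k,i}}-\rho_c\Big|\frac{\mathbf h_{k'}^H\mathbf w^{[t]}_{k',i}}{I^{[t]}_{k,i}}\Big|^2I_{k,i}\ \ge\ r_{k,i},\qquad \frac{2g^{[t]}_{k,i}}{B^{[t]}_{k,i}}g_{k,i}-\Big(\frac{g^{[t]}_{k,i}}{B^{[t]}_{k,i}}\Big)^2B_{k,i}\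 \ge\ d_{k,i};$$ $\begin{bmatrix}\mathbf Q_{k,i}&\mathbf w_{k,i}\\ \mathbf w_{k,i}^H&1\end{bmatrix}\succeq0$; the power constraints; and the mode constraint. (Superscript $[t]$ denotes the value at the $t$-th iterate.) **Proposition.** In either mode, if $(\mathbf w^{[t]}_{k,i},\mathbf Q^{[t]}_{k,i})\to(\mathbf w^{[\infty]}_{k,i},\mathbf Q^{[\infty]}_{k,i})$ as $t\to\infty$, then the limit is a KKT point of (P): it is feasible; if $w<1$, then $\sum_iG_{k,i}/B_{k,i}>0$ there for both $k$, so that the objective is defined; and there are $\lambda_k\ge0$, $\mathbf\Upsilon_{k,i}\succeq0$ and Hermitian $\mathbf V_k$ such that the Lagrangian $$-\big(wR-(1-w)\mu C\big)+\sum_k\lambda_k\Big(\sum_i\mathrm{tr}(\mathbf Q_{k,i})-2\Big)-\sum_{k,i}\mathrm{tr}\big(\mathbf\Upsilon_{k,i}(\mathbf Q_{k,i}-\mathbf w_{k,i}\mathbf w_{k,i}^H)\big)+\sum_k\mathrm{tr}(\mathbf V_k\mathbf E_k)$$ has zero gradient in $(\mathbf w,\mathbf Q)$ at the limit, where $\mathbf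 E_k=\mathbf Q_{k,1}-\mathbf Q_{k,2}$ in full-duplex mode and $\mathbf E_A=\mathbf Q_{A,2}$, $\mathbf E_B=\mathbf Q_{B,1}$ in half-duplex mode, and such that $\lambda_k(\sum_i\mathrm{tr}(\mathbf Q_{k,i})-2)=0$ and $\mathrm{tr}(\mathbf\Upsilon_{k,i}(\mathbf Q_{k,i}-\mathbf w_{k,i}\mathbf w_{k,i}^H))=0$ there for all $k,i$. -/

import Mathlib

open Filter Topology
open scoped Matrix ComplexOrder

attribute [local instance] Matrix.normedAddCommGroup Matrix.normedSpace

noncomputable section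

/-- The two duplex modes of the bidirectional system. -/
inductive DuplexMode where
  | full
  | half

/-- Parameters of a narrowband bidirectional ISAC system with `M` transmit antennas per transceiver.
The transceivers `A`, `B` are `0, 1 : Fin 2`; the two halves of the processing interval are also
indexed by `Fin 2`. -/
structure ISACSystem (M : ℕ) where
  /-- number of symbols in each half of the coherent processing interval -/
  N : ℕ
  /-- SNR of the communication signal -/
  rhoC : ℝ
  /-- SNR of the sensing echo -/
  rhoS : ℝ
  /-- residual self-interference factor (receiver dynamic range) -/
  rhoSI : ℝ
  /-- interference-to-noise ratio of the self-interference -/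
  eta : ℝ
  /-- signal wavelength -/
  wavelength : ℝ
  /-- antenna spacing -/
  spacing : ℝ
  /-- target angles -/
  theta : Fin 2 → ℝ
  /-- complex reflection coefficients -/
  alpha : Fin 2 → ℂ
  /-- communication channel from transceiver `k` to the other one -/
  h : Fin 2 → Fin M → ℂ
  /-- self-interference channel at transceiver `k` -/
  gSI : Fin 2 → Fin M → ℂ
  /-- weight between communication and sensing -/
  weight : ℝ
  /-- scaling of the CRB relative to the rate -/
  mu : ℝ
  N_pos : 0 < N
  rhoC_pos : 0 < rhoC
  rhoS_pos : 0 < rhoS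
  rhoSI_pos : 0 < rhoSI
  eta_pos : 0 < eta
  wavelength_pos : 0 < wavelength
  spacing_pos : 0 < spacing
  weight_nonneg : 0 ≤ weight
  weight_le_one : weight ≤ 1
  mu_pos : 0 < mu

/-- The design variables `(w, Q)`: beamformers `w k i` and transmit covariances `Q k i`, for
transceiver `k` and half-interval `i`. -/
abbrev Design (M : ℕ) : Type :=
  (Fin 2 → Fin 2 → Fin M → ℂ) × (Fin 2 → Fin 2 → Matrix (Fin M) (Fin M) ℂ)

/-- `vᴴ Q v` (real for Hermitian `Q`). -/
def hermQuad {M : ℕ} (v : Fin M → ℂ) (Q : Matrix (Fin M) (Fin M) ℂ) : ℝ :=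
  (star v ⬝ᵥ (Q *ᵥ v)).re

namespace ISACSystem

variable {M : ℕ} (S : ISACSystem M)

/-- Steering vector of a uniform linear array, as a function of the angle. -/
def steering (θ : ℝ) : Fin M → ℂ := fun m =>
  Complex.exp (Complex.I *
    ((2 * Real.pi / S.wavelength * (m : ℝ) * S.spacing * Real.sin θ : ℝ) : ℂ))

/-- Derivative of the steering vector with respect to the angle. -/
def steeringDot (θ : ℝ) : Fin M → ℂ := fun m => deriv (fun ϑ : ℝ => S.steering ϑ m) θ

/-- `Φ_{k,i} = η g_kᴴ Q_{k,i} g_k`. -/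
def Phi (x : Design M) (k i : Fin 2) : ℝ := S.eta * hermQuad (S.gSI k) (x.2 k i)

/-- Residual self-interference plus noise power `ρ_SI Φ_{k,i} + 1`. -/
def siNoise (x : Design M) (k i : Fin 2) : ℝ := S.rhoSI * S.Phi x k i + 1

/-- `I_{k,i} = ρ_s aᴴ Q_{k,i} a + ρ_SI Φ_{k,i} + 1`. -/
def interf (x : Design M) (k i : Fin 2) : ℝ :=
  S.rhoS * hermQuad (S.steering (S.theta k)) (x.2 k i) + S.rhoSI * S.Phi x k i + 1

/-- `h_{k'}ᴴ w_{k',i}`, where `k'` is the transceiver other than `k`. -/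
def signal (x : Design M) (k i : Fin 2) : ℂ := star (S.h k.rev) ⬝ᵥ x.1 k.rev i

/-- The SINR `γ_{k,i}`. -/
def sinr (x : Design M) (k i : Fin 2) : ℝ := S.rhoC * ‖S.signal x k i‖ ^ 2 / S.interf x k i

/-- The achievable rate `R_k`. -/
def rate (x : Design M) (k : Fin 2) : ℝ := 1 / 2 * ∑ i, Real.logb 2 (1 + S.sinr x k i)

/-- `G_{k,i} = |α_k|² ȧᴴ Q_{k,i} ȧ`. -/
def sensGain (x : Design M) (k i : Fin 2) : ℝ :=
  ‖S.alpha k‖ ^ 2 * hermQuad (S.steeringDot (S.theta k)) (x.2 k i)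

/-- `∑_i |α_k|² ȧᴴ Q_{k,i} ȧ / (ρ_SI Φ_{k,i} + 1)`, the normalized Fisher information. -/
def sensInfo (x : Design M) (k : Fin 2) : ℝ := ∑ i, S.sensGain x k i / S.siNoise x k i

/-- The Cramér–Rao bound `C_k`. -/
def crb (x : Design M) (k : Fin 2) : ℝ := 1 / (2 * S.rhoS * S.N) * (S.sensInfo x k)⁻¹

/-- The weighted-sum objective `w R - (1 - w) μ C`. -/
def objective (x : Design M) : ℝ :=
  S.weight * ∑ k, S.rate x k - (1 - S.weight) * S.mu * ∑ k, S.crb x k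

end ISACSystem

/-- The matrix which the duplex mode forces to vanish for transceiver `k`:
`Q_{k,1} - Q_{k,2}` in full duplex; `Q_{A,2}` resp. `Q_{B,1}` in half duplex. -/
def modeResidual {M : ℕ} (m : DuplexMode) (x : Design M) (k : Fin 2) : Matrix (Fin M) (Fin M) ℂ :=
  match m with
  | .full => x.2 k 0 - x.2 k 1
  | .half => x.2 k k.rev

/-- The duplex mode constraint. -/
def ModeConstraint {M : ℕ} (m : DuplexMode) (x : Design M) : Prop := ∀ k, modeResidual m x k = 0

/-- The half-intervals in which transceiver `k` transmits. -/
def Transmits (m : DuplexMode) (k i : Fin 2) : Prop :=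
  match m with
  | .full => True
  | .half => i = k

/-- `∑_i tr Q_{k,i} - 2`. -/
def powerExcess {M : ℕ} (x : Design M) (k : Fin 2) : ℝ := (∑ i, (x.2 k i).trace).re - 2

/-- `Q_{k,i} - w_{k,i} w_{k,i}ᴴ`. -/
def sensCov {M : ℕ} (x : Design M) (k i : Fin 2) : Matrix (Fin M) (Fin M) ℂ :=
  x.2 k i - Matrix.vecMulVec (x.1 k i) (star (x.1 k i))

/-- The block matrix `[Q_{k,i}, w_{k,i}; w_{k,i}ᴴ, 1]`. -/
def schurBlock {M : ℕ} (x : Design M) (k i : Fin 2) :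
    Matrix (Fin M ⊕ Unit) (Fin M ⊕ Unit) ℂ :=
  Matrix.fromBlocks (x.2 k i) (Matrix.replicateCol Unit (x.1 k i))
    (Matrix.replicateCol Unit (x.1 k i))ᴴ 1

/-- Feasibility for the weighted-sum problem: mode, average power, `Q_{k,i} ⪰ w_{k,i} w_{k,i}ᴴ`. -/
structure IsFeasible {M : ℕ} (m : DuplexMode) (x : Design M) : Prop where
  mode : ModeConstraint m x
  power : ∀ k, powerExcess x k ≤ 0
  psd : ∀ k i, (sensCov x k i).PosSemidef

namespace ISACSystem

variable {M : ℕ} (S : ISACSystem M)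

/-- Lagrangian of the weighted-sum problem (written as minimization of `-objective`), with
multipliers `lam k` of the power constraints, `U k i` of `Q_{k,i} ⪰ w_{k,i} w_{k,i}ᴴ`, and `V k` of
the mode constraints. -/
def lagrangian (m : DuplexMode) (lam : Fin 2 → ℝ)
    (U : Fin 2 → Fin 2 → Matrix (Fin M) (Fin M) ℂ) (V : Fin 2 → Matrix (Fin M) (Fin M) ℂ)
    (x : Design M) : ℝ :=
  -S.objective x + ∑ k, lam k * powerExcess x k
    - ∑ k, ∑ i, (U k i * sensCov x k i).trace.re
    + ∑ k, (V k * modeResidual m x k).trace.re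

/-- `x` is a KKT point of the weighted-sum problem: it is feasible, the objective is well defined at
`x` (for `weight = 1` the CRB does not enter the objective), and multipliers exist for which dual
feasibility, stationarity (in the real variables underlying `w` and `Q`) and complementary
slackness hold. -/
structure IsKKTPoint (m : DuplexMode) (x : Design M) : Prop where
  feasible : IsFeasible m x
  objective_defined : S.weight < 1 → ∀ k, 0 < S.sensInfo x k
  multipliers : ∃ (lam : Fin 2 → ℝ) (U : Fin 2 → Fin 2 → Matrix (Fin M) (Fin M) ℂ)
      (V : Fin 2 → Matrix (Fin M) (Fin M) ℂ),
    (∀ k, 0 ≤ lam k) ∧ (∀ k i, (U k i).PosSemidef) ∧ (∀ k, (V k).IsHermitian) ∧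
    HasFDerivAt (S.lagrangian m lam U V) (0 : Design M →L[ℝ] ℝ) x ∧
    (∀ k, lam k * powerExcess x k = 0) ∧
    (∀ k i, (U k i * sensCov x k i).trace = 0)

/-- Surrogate `γ_{k,i}^{[t]}` of the SINR, built at `y` and evaluated at `x`. -/
def sinrSurrogate (y x : Design M) (k i : Fin 2) : ℝ :=
  2 * S.rhoC * (star (S.signal y k i) * S.signal x k i).re / S.interf y k i
    - S.rhoC * ‖S.signal y k i / (S.interf y k i : ℂ)‖ ^ 2 * S.interf x k i

/-- Surrogate `D_{k,i}^{[t]}` of `g_{k,i}² / (ρ_SI Φ_{k,i} + 1)`, built at `(y, gy)` and evaluated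
at `(x, g)`. -/
def sensSurrogate (y : Design M) (gy : Fin 2 → Fin 2 → ℝ) (x : Design M) (g : Fin 2 → Fin 2 → ℝ)
    (k i : Fin 2) : ℝ :=
  2 * gy k i / S.siNoise y k i * g k i - (gy k i / S.siNoise y k i) ^ 2 * S.siNoise x k i

/-- The objective `f(w, r, d)` of the reformulated problem. -/
def auxObjective (r d : Fin 2 → Fin 2 → ℝ) : ℝ :=
  S.weight / 2 * ∑ k, ∑ i, Real.logb 2 (1 + r k i)
    - (1 - S.weight) * S.mu / (2 * S.rhoS * S.N) * ∑ k, (∑ i, d k i)⁻¹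

end ISACSystem

/-- Sign condition on the sensing auxiliary variables `g`, `d`: positive in the half-intervals in
which the transceiver transmits. In an idle half-interval `Q_{k,i} = 0` leaves only the value `0`,
hence nonnegativity there. -/
def AuxSign (m : DuplexMode) (g : Fin 2 → Fin 2 → ℝ) : Prop :=
  ∀ k i, 0 ≤ g k i ∧ (Transmits m k i → 0 < g k i)

/-- A point `(w, Q, r, g, d)` of the convex subproblem. -/
structure SubPoint (M : ℕ) where
  x : Design M
  r : Fin 2 → Fin 2 → ℝ
  g : Fin 2 → Fin 2 → ℝ
  d : Fin 2 → Fin 2 → ℝ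

namespace ISACSystem

variable {M : ℕ} (S : ISACSystem M)

/-- Feasibility for the convex subproblem built at `(y, gy)`. -/
structure SubFeasible (m : DuplexMode) (y : Design M) (gy : Fin 2 → Fin 2 → ℝ)
    (p : SubPoint M) : Prop where
  r_nonneg : ∀ k i, 0 ≤ p.r k i
  g_sign : AuxSign m p.g
  d_sign : AuxSign m p.d
  sinr : ∀ k i, p.r k i ≤ S.sinrSurrogate y p.x k i
  gain : ∀ k i, p.g k i ^ 2 ≤ S.sensGain p.x k i
  sens : ∀ k i, p.d k i ≤ S.sensSurrogate y gy p.x p.g k i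
  mode : ModeConstraint m p.x
  power : ∀ k, powerExcess p.x k ≤ 0
  schur : ∀ k i, (schurBlock p.x k i).PosSemidef

/-- `p` is a (global) solution of the convex subproblem built at `(y, gy)`. -/
def SubSolution (m : DuplexMode) (y : Design M) (gy : Fin 2 → Fin 2 → ℝ) (p : SubPoint M) : Prop :=
  S.SubFeasible m y gy p ∧
    ∀ q : SubPoint M, S.SubFeasible m y gy q → S.auxObjective q.r q.d ≤ S.auxObjective p.r p.d

/-- `(x t, g t)` are the iterates of the SCA algorithm, run without stopping: it starts at a
feasible `(w, Q, g)`, and each new `(w, Q, g)` comes from a solution of the convex subproblem built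
at the previous one. -/
structure IsSCARun (m : DuplexMode) (x : ℕ → Design M) (g : ℕ → Fin 2 → Fin 2 → ℝ) : Prop where
  init_feasible : IsFeasible m (x 0)
  init_sign : AuxSign m (g 0)
  init_gain : ∀ k i, g 0 k i ^ 2 ≤ S.sensGain (x 0) k i
  step : ∀ t, ∃ r d : Fin 2 → Fin 2 → ℝ,
    S.SubSolution m (x t) (g t) ⟨x (t + 1), r, g (t + 1), d⟩

end ISACSystem

end

/-! Both surrogates come from one completed square: 2ca - c²b ≤ a²/b for b > 0, with equality at c =
a/b. They lie below the SINR and the sensing ratio and touch them at the current iterate. Each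
iterate is therefore admissible for its own subproblem, and the optimal values never decrease. Since
the rates converge along the run, this bounds the CRB, so the Fisher information stays positive in
the limit when `weight < 1` (`sensInfo_limit_pos`).

Fix a feasible z and a small ε > 0. For large t the point (1-ε)x_t + εz is admissible for subproblem
t, so its surrogate value is at most the objective at x_{t+1}. Letting t → ∞ and then ε → 0 makes
the derivative of the surrogate at the limit nonpositive towards z, and by tangency the derivative
of the objective too. Two points need care. First, g_t has to converge: for `weight < 1` the gain
constraint is active (`eq_sqrt_sensGain`), and for `weight = 1` the objective ignores g. Second, r ≥
0 may exclude the point if a received signal vanishes in the limit. The corresponding beam of z is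
then replaced by 0, which does not change the derivative of the objective, because the objective is
even in that direction.

The limit thus maximizes the linearized objective over the convex feasible set. On the subspace cut
out by the mode constraint, without idle beams, Slater's condition holds, and separation yields λ
and Υ (`exists_multipliers_of_linear_max`). The gradient that remains vanishes on this subspace and
is invariant under Q ↦ Qᴴ. Hence it factors through the mode residuals, and this factorization
supplies the Hermitian V (`eq_sum_pivotEmbed`). -/

noncomputable section

/-! ### Hermitian forms and real-linear functionals on matrices -/

section HermQuad

variable {M : ℕ}

theorem hermQuad_add (v : Fin M → ℂ) (P Q : Matrix (Fin M) (Fin M) ℂ) :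
    hermQuad v (P + Q) = hermQuad v P + hermQuad v Q := by
  simp [hermQuad, Matrix.add_mulVec, dotProduct_add]

theorem hermQuad_smul (v : Fin M → ℂ) (c : ℝ) (Q : Matrix (Fin M) (Fin M) ℂ) :
    hermQuad v (c • Q) = c * hermQuad v Q := by
  simp [hermQuad, Matrix.smul_mulVec, dotProduct_smul]

/-- `Q ↦ vᴴ Q v` as a continuous real-linear functional. -/
def hermQuadCLM (v : Fin M → ℂ) : Matrix (Fin M) (Fin M) ℂ →L[ℝ] ℝ :=
  LinearMap.toContinuousLinearMap
    { toFun := hermQuad v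
      map_add' := hermQuad_add v
      map_smul' := hermQuad_smul v }

theorem hermQuad_zero (v : Fin M → ℂ) : hermQuad v (0 : Matrix (Fin M) (Fin M) ℂ) = 0 := by
  simp [hermQuad]

theorem hermQuad_sub (v : Fin M → ℂ) (P Q : Matrix (Fin M) (Fin M) ℂ) :
    hermQuad v (P - Q) = hermQuad v P - hermQuad v Q :=
  (hermQuadCLM v).map_sub P Q

theorem hermQuad_conjTranspose (v : Fin M → ℂ) (Q : Matrix (Fin M) (Fin M) ℂ) :
    hermQuad v Qᴴ = hermQuad v Q := by
  unfold hermQuad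
  have : star v ⬝ᵥ (Qᴴ *ᵥ v) = star (star v ⬝ᵥ (Q *ᵥ v)) := by
    rw [Matrix.star_dotProduct, Matrix.star_mulVec, Matrix.dotProduct_mulVec]
    simp
  rw [this]
  simp

theorem hermQuad_vecMulVec (v w : Fin M → ℂ) :
    hermQuad v (Matrix.vecMulVec w (star w)) = ‖star v ⬝ᵥ w‖ ^ 2 := by
  have h : star w ⬝ᵥ v = star (star v ⬝ᵥ w) := by
    rw [Matrix.star_dotProduct]
  rw [hermQuad, Matrix.vecMulVec_mulVec, h]
  simp only [dotProduct_smul, MulOpposite.smul_eq_mul_unop, MulOpposite.unop_op]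
  rw [← Complex.normSq_eq_norm_sq, ← Complex.ofReal_re (Complex.normSq _),
    ← Complex.mul_conj]
  rfl

theorem posSemidef_iff_hermQuad {Q : Matrix (Fin M) (Fin M) ℂ} :
    Q.PosSemidef ↔ Q.IsHermitian ∧ ∀ v, 0 ≤ hermQuad v Q := by
  rw [Matrix.posSemidef_iff_dotProduct_mulVec]
  refine and_congr_right fun hQ => forall_congr' fun v => ?_
  rw [Complex.le_def]
  have him : (star v ⬝ᵥ (Q *ᵥ v)).im = 0 := hQ.im_star_dotProduct_mulVec_self v
  simp [hermQuad, him]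

theorem hermQuad_one (v : Fin M → ℂ) :
    hermQuad v (1 : Matrix (Fin M) (Fin M) ℂ) = ∑ a, ‖v a‖ ^ 2 := by
  simp only [hermQuad, Matrix.one_mulVec, dotProduct, Complex.re_sum]
  refine Finset.sum_congr rfl fun a _ => ?_
  rw [← Complex.normSq_eq_norm_sq, Complex.normSq_apply]
  simp

theorem re_trace_mul_vecMulVec (U : Matrix (Fin M) (Fin M) ℂ) (v : Fin M → ℂ) :
    (U * Matrix.vecMulVec v (star v)).trace.re = hermQuad v U := by
  rw [Matrix.mul_vecMulVec, Matrix.trace_vecMulVec, hermQuad, dotProduct_comm]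

theorem abs_hermQuad_le (v : Fin M → ℂ) (E : Matrix (Fin M) (Fin M) ℂ) :
    |hermQuad v E| ≤ ‖E‖ * M * ∑ a, ‖v a‖ ^ 2 := by
  have h1 : |hermQuad v E| ≤ ∑ a, ∑ b, ‖v a‖ * (‖E‖ * ‖v b‖) := by
    refine (Complex.abs_re_le_norm _).trans ?_
    simp only [dotProduct, Matrix.mulVec, Finset.mul_sum]
    refine (norm_sum_le _ _).trans (Finset.sum_le_sum fun a _ => ?_)
    refine (norm_sum_le _ _).trans (Finset.sum_le_sum fun b _ => ?_)
    rw [norm_mul, norm_mul]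
    have := Matrix.norm_entry_le_entrywise_sup_norm E (i := a) (j := b)
    simp only [Pi.star_apply, norm_star]
    gcongr
  refine h1.trans ?_
  have h2 : ∑ a, ∑ b, ‖v a‖ * (‖E‖ * ‖v b‖) = ‖E‖ * (∑ a, ‖v a‖) ^ 2 := by
    rw [sq, Finset.sum_mul_sum, Finset.mul_sum]
    refine Finset.sum_congr rfl fun a _ => ?_
    rw [Finset.mul_sum]
    exact Finset.sum_congr rfl fun b _ => by ring
  rw [h2, mul_assoc]
  have h3 := sq_sum_le_card_mul_sum_sq (s := Finset.univ) (f := fun a => ‖v a‖)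
  simp only [Finset.card_univ, Fintype.card_fin] at h3
  gcongr

theorem eventually_hermQuad_nonneg {c : ℝ} (hc : 0 < c) :
    ∀ᶠ Y in 𝓝 (c • (1 : Matrix (Fin M) (Fin M) ℂ)), ∀ v, 0 ≤ hermQuad v Y := by
  -- The form is at most M times the entrywise sup norm times the squared length of v; M + 1 also
  -- covers M = 0.
  have hδ : 0 < c / (M + 1) := by positivity
  filter_upwards [Metric.ball_mem_nhds _ hδ] with Y hY v
  have h1 := abs_le.1 (abs_hermQuad_le v (Y - c • 1))
  rw [hermQuad_sub, hermQuad_smul, hermQuad_one] at h1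
  have h2 : ‖Y - c • (1 : Matrix (Fin M) (Fin M) ℂ)‖ < c / (M + 1) := by
    rwa [mem_ball_iff_norm] at hY
  have h3 : ‖Y - c • (1 : Matrix (Fin M) (Fin M) ℂ)‖ * M ≤ c := by
    rw [lt_div_iff₀ (by positivity)] at h2
    nlinarith [norm_nonneg (Y - c • (1 : Matrix (Fin M) (Fin M) ℂ))]
  have h4 : 0 ≤ ∑ a, ‖v a‖ ^ 2 := by positivity
  nlinarith [mul_le_mul_of_nonneg_right h3 h4, h1.1]

/-- A real-linear functional on matrices invariant under the conjugate transpose is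
`Y ↦ Re tr (U Y)` for some Hermitian `U`. -/
theorem exists_isHermitian_re_trace_mul (ν : Matrix (Fin M) (Fin M) ℂ →ₗ[ℝ] ℝ)
    (hν : ∀ Y, ν Yᴴ = ν Y) :
    ∃ U : Matrix (Fin M) (Fin M) ℂ, U.IsHermitian ∧ ∀ Y, ν Y = (U * Y).trace.re := by
  -- For real p, q the real part of (p - iq)(s + it) is ps + qt, which dictates the entries of U.
  refine ⟨Matrix.of fun b a => (ν (Matrix.single a b 1) : ℂ) -
    Complex.I * (ν (Matrix.single a b Complex.I) : ℂ), ?_, fun Y => ?_⟩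
  · ext b a
    have h1 : ν (Matrix.single b a 1) = ν (Matrix.single a b 1) := by
      rw [← hν]; simp
    have h2 : ν (Matrix.single b a Complex.I) = -ν (Matrix.single a b Complex.I) := by
      rw [← hν, ← map_neg]; simp [Matrix.single_neg]
    simp [Matrix.conjTranspose_apply, h1, h2, sub_eq_add_neg]
  · conv_lhs => rw [Matrix.matrix_eq_sum_single Y]
    simp only [map_sum, Matrix.trace, Matrix.diag, Matrix.mul_apply, Complex.re_sum]
    rw [Finset.sum_comm]
    refine Finset.sum_congr rfl fun b _ => Finset.sum_congr rfl fun a _ => ?_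
    have h : Matrix.single a b (Y a b) = (Y a b).re • Matrix.single a b (1 : ℂ) +
        (Y a b).im • Matrix.single a b Complex.I := by
      rw [Matrix.smul_single, Matrix.smul_single, ← Matrix.single_add]
      congr 1
      simp [Complex.re_add_im]
    rw [h, map_add, map_smul, map_smul]
    simp
    ring

end HermQuad

/-! ### Convex duality by separation -/

open scoped Pointwise in
/-- Lagrange multipliers under Slater's condition, for a linear objective `f` on a convex set `C`
and a constraint `G x ∈ K` with `G` concave relative to the cone `K`. -/
theorem exists_nonneg_multiplier {E V : Type*} [AddCommGroup E] [Module ℝ E]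
    [AddCommGroup V] [Module ℝ V] [TopologicalSpace V] [IsTopologicalAddGroup V]
    [ContinuousSMul ℝ V] {C : Set E} (hC : Convex ℝ C) (K : PointedCone ℝ V) (f : E →ₗ[ℝ] ℝ)
    (G : E → V)
    (hG : ∀ x ∈ C, ∀ y ∈ C, ∀ a b : ℝ, 0 ≤ a → 0 ≤ b → a + b = 1 →
      G (a • x + b • y) - (a • G x + b • G y) ∈ K)
    {x₁ : E} (hx₁ : x₁ ∈ C) (hslater : G x₁ ∈ interior (K : Set V))
    {x₀ : E} (hx₀ : x₀ ∈ C) (hGx₀ : G x₀ ∈ K) (hmax : ∀ x ∈ C, G x ∈ K → f x ≤ f x₀) :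
    ∃ μ : V →L[ℝ] ℝ, (∀ v ∈ K, 0 ≤ μ v) ∧ ∀ x ∈ C, f x - f x₀ + μ (G x) ≤ 0 := by
  have hsmul : ∀ (c : ℝ), 0 ≤ c → ∀ v ∈ K, c • v ∈ K := fun c hc v hv =>
    K.smul_mem hc hv
  -- A point of T with positive first and interior second coordinate would come from a feasible x
  -- with f x > f x₀.
  set T : Set (ℝ × V) := {p | ∃ x ∈ C, p.1 ≤ f x - f x₀ ∧ G x - p.2 ∈ K}
  have hTconv : Convex ℝ T := by
    rintro ⟨r, v⟩ ⟨x, hx, hr, hv⟩ ⟨r', v'⟩ ⟨y, hy, hr', hv'⟩ a b ha hb hab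
    refine ⟨a • x + b • y, hC hx hy ha hb hab, ?_, ?_⟩
    · simp only [Prod.fst_add, Prod.smul_fst, smul_eq_mul, map_add, map_smul] at *
      have : f x₀ = a * f x₀ + b * f x₀ := by rw [← add_mul, hab, one_mul]
      rw [this]
      nlinarith [mul_le_mul_of_nonneg_left hr ha, mul_le_mul_of_nonneg_left hr' hb]
    · have h := K.add_mem (hG x hx y hy a b ha hb hab)
        (K.add_mem (hsmul a ha _ hv) (hsmul b hb _ hv'))
      convert h using 1
      simp only [Prod.snd_add, Prod.smul_snd, smul_sub]
      abel
  have hdisj : Disjoint (Set.Ioi (0 : ℝ) ×ˢ interior (K : Set V)) T := by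
    rw [Set.disjoint_left]
    rintro ⟨r, v⟩ ⟨hr, hv⟩ ⟨x, hx, hrx, hvx⟩
    have h : G x ∈ K := by
      have := K.add_mem hvx (interior_subset hv : v ∈ (K : Set V))
      simpa using this
    have := hmax x hx h
    simp only [Set.mem_Ioi] at hr
    simp only at hrx
    linarith
  have hKconv : Convex ℝ (K : Set V) := fun x hx y hy a b ha hb _ =>
    K.add_mem (hsmul a ha _ hx) (hsmul b hb _ hy)
  obtain ⟨φ, u, hU, hφT⟩ := geometric_hahn_banach_open
    ((convex_Ioi (0 : ℝ)).prod hKconv.interior) (isOpen_Ioi.prod isOpen_interior) hTconv hdisj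
  have hφ : ∀ r v, φ (r, v) = r * φ (1, 0) + φ (0, v) := fun r v => by
    have : ((r, v) : ℝ × V) = r • ((1 : ℝ), (0 : V)) + (0, v) := by ext <;> simp
    rw [this, map_add, map_smul, smul_eq_mul]
  have hφs : ∀ (r : ℝ) v, φ (0, r • v) = r * φ (0, v) := fun r v => by
    have : ((0, r • v) : ℝ × V) = r • ((0 : ℝ), v) := by ext <;> simp
    rw [this, map_smul, smul_eq_mul]
  -- The open set contains δ(1, G x₁) for every δ > 0 and so accumulates at the origin, where φ is
  -- 0.
  have hu : 0 ≤ u := by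
    have hmem : ∀ δ : ℝ, 0 < δ → δ * φ (1, G x₁) < u := fun δ hδ => by
      have h1 : δ • G x₁ ∈ interior (K : Set V) := by
        have h2 : δ • G x₁ ∈ δ • interior (K : Set V) := Set.smul_mem_smul_set hslater
        rw [← interior_smul₀ hδ.ne'] at h2
        refine interior_mono ?_ h2
        rintro _ ⟨v, hv, rfl⟩
        exact hsmul δ hδ.le v hv
      have := hU (δ, δ • G x₁) ⟨hδ, h1⟩
      rw [hφ, hφs] at this
      rw [hφ]
      linarith
    by_contra! hneg
    have h1 := hmem 1 one_pos
    have h2 : φ (1, G x₁) < 0 := by linarith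
    have h3 := hmem (u / (2 * φ (1, G x₁))) (by
      apply div_pos_of_neg_of_neg hneg; linarith)
    have h4 : u / (2 * φ (1, G x₁)) * φ (1, G x₁) = u / 2 := by
      have := h2.ne
      field_simp
    linarith
  have hdir : ∀ x ∈ C, 0 ≤ φ (f x - f x₀, G x) := fun x hx =>
    hu.trans (hφT _ ⟨x, hx, le_rfl, by simp⟩)
  have hneg : φ (1, 0) < 0 := by
    have h1 := hU (1, G x₁) ⟨Set.mem_Ioi.2 one_pos, hslater⟩
    have hu0 : u ≤ 0 := by
      have h2 := hφT (0, 0) ⟨x₀, hx₀, by simp, by simpa using hGx₀⟩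
      have h3 : φ (0, 0) = 0 := map_zero φ
      linarith
    have h2 : φ (1, 0) ≤ 0 := by
      by_contra! hpos
      -- T is closed under lowering the first coordinate; this value brings φ down to u - 1.
      have h3 := hφT (-(1 - u) / φ (1, 0), 0) ⟨x₀, hx₀, by
        simp only [sub_self]
        apply div_nonpos_of_nonpos_of_nonneg _ hpos.le
        linarith, by simpa using hGx₀⟩
      rw [hφ, div_mul_cancel₀ _ hpos.ne'] at h3
      have h4 : φ (0, 0) = 0 := map_zero φ
      linarith
    -- Slater's condition enters here: if φ (1, 0) = 0, then φ (0, G x₁) is negative by separation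
    -- and nonnegative by `hdir`.
    refine lt_of_le_of_ne h2 fun h0 => ?_
    have h3 := hdir x₁ hx₁
    rw [hφ, h0] at h1 h3
    linarith
  refine ⟨(φ (1, 0))⁻¹ • (φ.comp (ContinuousLinearMap.inr ℝ ℝ V)), fun v hv => ?_, fun x hx => ?_⟩
  · have h1 : φ (0, v) ≤ 0 := by
      by_contra! hpos
      -- T is closed under subtracting elements of K from the second coordinate; this multiple of v
      -- brings φ to u - 1.
      have h2 := hφT (0, G x₀ - ((φ (0, G x₀) + 1 - u) / φ (0, v)) • v) ⟨x₀, hx₀, by simp, by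
        simp only [sub_sub_cancel]
        refine hsmul _ (div_nonneg ?_ hpos.le) v hv
        have h3 := hφT (0, G x₀) ⟨x₀, hx₀, by simp, by simp⟩
        linarith⟩
      have h4 : ((0, G x₀ - ((φ (0, G x₀) + 1 - u) / φ (0, v)) • v) : ℝ × V) =
          (0, G x₀) - (0, ((φ (0, G x₀) + 1 - u) / φ (0, v)) • v) := by ext <;> simp
      rw [h4, map_sub, hφs, div_mul_cancel₀ _ hpos.ne'] at h2
      linarith
    simp only [smul_apply, ContinuousLinearMap.comp_apply,
      ContinuousLinearMap.inr_apply, smul_eq_mul]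
    exact mul_nonneg_of_nonpos_of_nonpos (inv_nonpos.2 hneg.le) h1
  · simp only [smul_apply, ContinuousLinearMap.comp_apply,
      ContinuousLinearMap.inr_apply, smul_eq_mul]
    have h1 := hdir x hx
    rw [hφ] at h1
    have h2 := mul_nonpos_of_nonpos_of_nonneg (inv_nonpos.2 hneg.le) h1
    have h3 : (φ (1, 0))⁻¹ * ((f x - f x₀) * φ (1, 0) + φ (0, G x)) =
        f x - f x₀ + (φ (1, 0))⁻¹ * φ (0, G x) := by
      have := hneg.ne
      field_simp
    linarith

/-! ### Behaviour of the constraints and signal quantities under convex combinations -/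

section Affine

variable {M : ℕ} (S : ISACSystem M) (m : DuplexMode) (x z : Design M) (k i : Fin 2)

theorem differentiable_hermQuad (v : Fin M → ℂ) :
    Differentiable ℝ (fun x : Design M => hermQuad v (x.2 k i)) :=
  (hermQuadCLM v).differentiable.comp (by fun_prop : Differentiable ℝ fun x : Design M => x.2 k i)

theorem hermQuad_combo (v : Fin M → ℂ) (a b : ℝ) :
    hermQuad v ((a • x + b • z).2 k i) = a * hermQuad v (x.2 k i) + b * hermQuad v (z.2 k i) := by
  rw [← hermQuad_smul, ← hermQuad_smul, ← hermQuad_add]; rfl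

theorem powerExcess_combo {a b : ℝ} (hab : a + b = 1) :
    powerExcess (a • x + b • z) k = a * powerExcess x k + b * powerExcess z k := by
  simp only [powerExcess, Fin.sum_univ_two, Prod.snd_add, Prod.smul_snd, Pi.add_apply,
    Pi.smul_apply, Matrix.trace_add, Matrix.trace_smul, Complex.add_re, Complex.real_smul,
    Complex.re_ofReal_mul]
  linear_combination (2 : ℝ) * hab

theorem modeResidual_combo (a b : ℝ) :
    modeResidual m (a • x + b • z) k = a • modeResidual m x k + b • modeResidual m z k := by
  cases m
  · simp only [modeResidual, Prod.snd_add, Prod.smul_snd, Pi.add_apply, Pi.smul_apply, smul_sub]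
    abel
  · rfl

theorem hermQuad_sensCov (v : Fin M → ℂ) :
    hermQuad v (sensCov x k i) = hermQuad v (x.2 k i) - ‖star v ⬝ᵥ x.1 k i‖ ^ 2 := by
  rw [sensCov, hermQuad_sub, hermQuad_vecMulVec]

/-- The form is linear in Q minus |vᴴw|², and the squared norm is convex. -/
theorem le_hermQuad_sensCov_combo (v : Fin M → ℂ) {a b : ℝ} (ha : 0 ≤ a) (hb : 0 ≤ b)
    (hab : a + b = 1) :
    a * hermQuad v (sensCov x k i) + b * hermQuad v (sensCov z k i) ≤
      hermQuad v (sensCov (a • x + b • z) k i) := by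
  simp only [hermQuad_sensCov, hermQuad_combo]
  have h1 : star v ⬝ᵥ (a • x + b • z).1 k i =
      a • (star v ⬝ᵥ x.1 k i) + b • (star v ⬝ᵥ z.1 k i) := by
    rw [← dotProduct_smul, ← dotProduct_smul, ← dotProduct_add]; rfl
  rw [h1]
  have h2 : ConvexOn ℝ Set.univ fun c : ℂ => ‖c‖ ^ 2 :=
    convexOn_univ_norm.pow (fun _ _ => norm_nonneg _) 2
  have h3 := h2.2 (Set.mem_univ (star v ⬝ᵥ x.1 k i)) (Set.mem_univ (star v ⬝ᵥ z.1 k i)) ha hb hab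
  simp only [smul_eq_mul] at h3
  linarith

theorem isHermitian_sensCov_iff : (sensCov x k i).IsHermitian ↔ (x.2 k i).IsHermitian := by
  have h : (Matrix.vecMulVec (x.1 k i) (star (x.1 k i))).IsHermitian := by
    rw [Matrix.IsHermitian, Matrix.conjTranspose_vecMulVec, star_star]
  constructor
  · intro h'
    simpa [sensCov] using h'.add h
  · intro h'
    exact h'.sub h

/-- Schur complement of the lower right block 1. The subproblems and (P) thus share the same
feasible designs, up to the auxiliary constraints. -/
theorem posSemidef_schurBlock_iff :
    (schurBlock x k i).PosSemidef ↔ (sensCov x k i).PosSemidef := by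
  have : Invertible (1 : Matrix Unit Unit ℂ) := invertibleOne
  rw [schurBlock, Matrix.PosDef.fromBlocks₂₂ _ _ Matrix.PosDef.one]
  have : Matrix.replicateCol Unit (x.1 k i) * (1 : Matrix Unit Unit ℂ)⁻¹ *
      (Matrix.replicateCol Unit (x.1 k i))ᴴ = Matrix.vecMulVec (x.1 k i) (star (x.1 k i)) := by
    ext a b
    simp [Matrix.mul_apply, Matrix.vecMulVec_apply]
  rw [this, sensCov]

namespace ISACSystem

theorem differentiable_siNoise : Differentiable ℝ fun x : Design M => S.siNoise x k i := by
  have := differentiable_hermQuad k i (S.gSI k)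
  unfold siNoise Phi
  fun_prop

theorem differentiable_interf : Differentiable ℝ fun x : Design M => S.interf x k i := by
  have := differentiable_hermQuad k i (S.gSI k)
  have := differentiable_hermQuad k i (S.steering (S.theta k))
  unfold interf Phi
  fun_prop

theorem differentiable_sensGain : Differentiable ℝ fun x : Design M => S.sensGain x k i := by
  have := differentiable_hermQuad k i (S.steeringDot (S.theta k))
  unfold sensGain
  fun_prop

theorem differentiable_signal : Differentiable ℝ fun x : Design M => S.signal x k i := by
  unfold signal dotProduct
  fun_prop

theorem differentiable_normSq_signal :
    Differentiable ℝ fun x : Design M => ‖S.signal x k i‖ ^ 2 :=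
  (S.differentiable_signal k i).norm_sq ℝ

theorem siNoise_combo {a b : ℝ} (hab : a + b = 1) :
    S.siNoise (a • x + b • z) k i = a * S.siNoise x k i + b * S.siNoise z k i := by
  simp only [siNoise, Phi, hermQuad_combo]
  linear_combination -hab

theorem interf_combo {a b : ℝ} (hab : a + b = 1) :
    S.interf (a • x + b • z) k i = a * S.interf x k i + b * S.interf z k i := by
  simp only [interf, Phi, hermQuad_combo]
  linear_combination -hab

theorem sensGain_combo (a b : ℝ) :
    S.sensGain (a • x + b • z) k i = a * S.sensGain x k i + b * S.sensGain z k i := by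
  simp only [sensGain, hermQuad_combo]
  ring

theorem signal_combo (a b : ℝ) :
    S.signal (a • x + b • z) k i = a * S.signal x k i + b * S.signal z k i := by
  rw [← Complex.real_smul, ← Complex.real_smul]
  simp only [signal, ← dotProduct_smul, ← dotProduct_add]
  rfl

end ISACSystem

end Affine

/-! ### The feasible set: lower bounds, convexity, closedness -/

namespace IsFeasible

variable {M : ℕ} {m : DuplexMode} {x z : Design M}

theorem isHermitian (h : IsFeasible m x) (k i : Fin 2) : (x.2 k i).IsHermitian :=
  (isHermitian_sensCov_iff x k i).1 (h.psd k i).isHermitian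

theorem hermQuad_nonneg (h : IsFeasible m x) (k i : Fin 2) (v : Fin M → ℂ) :
    0 ≤ hermQuad v (x.2 k i) := by
  have h1 := (posSemidef_iff_hermQuad.1 (h.psd k i)).2 v
  rw [hermQuad_sensCov] at h1
  nlinarith [sq_nonneg ‖star v ⬝ᵥ x.1 k i‖]

theorem one_le_siNoise (h : IsFeasible m x) (S : ISACSystem M) (k i : Fin 2) :
    1 ≤ S.siNoise x k i := by
  have h1 := h.hermQuad_nonneg k i (S.gSI k)
  have h2 := S.rhoSI_pos
  have h3 := S.eta_pos
  have : 0 ≤ S.rhoSI * (S.eta * hermQuad (S.gSI k) (x.2 k i)) := by positivity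
  unfold ISACSystem.siNoise ISACSystem.Phi
  linarith

theorem one_le_interf (h : IsFeasible m x) (S : ISACSystem M) (k i : Fin 2) :
    1 ≤ S.interf x k i := by
  have h1 := h.one_le_siNoise S k i
  have h2 := mul_nonneg S.rhoS_pos.le (h.hermQuad_nonneg k i (S.steering (S.theta k)))
  unfold ISACSystem.siNoise at h1
  unfold ISACSystem.interf
  linarith

theorem sensGain_nonneg (h : IsFeasible m x) (S : ISACSystem M) (k i : Fin 2) :
    0 ≤ S.sensGain x k i :=
  mul_nonneg (sq_nonneg _) (h.hermQuad_nonneg k i _)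

theorem sinr_nonneg (h : IsFeasible m x) (S : ISACSystem M) (k i : Fin 2) :
    0 ≤ S.sinr x k i :=
  div_nonneg (mul_nonneg S.rhoC_pos.le (sq_nonneg _))
    (zero_le_one.trans (h.one_le_interf S k i))

theorem of_hermQuad (hmode : ModeConstraint m x) (hpow : ∀ k, powerExcess x k ≤ 0)
    (hherm : ∀ k i, (x.2 k i).IsHermitian)
    (hquad : ∀ k i v, 0 ≤ hermQuad v (sensCov x k i)) : IsFeasible m x :=
  ⟨hmode, hpow, fun k i => posSemidef_iff_hermQuad.2
    ⟨(isHermitian_sensCov_iff x k i).2 (hherm k i), hquad k i⟩⟩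

theorem hermQuad_sensCov_nonneg (h : IsFeasible m x) (k i : Fin 2) (v : Fin M → ℂ) :
    0 ≤ hermQuad v (sensCov x k i) :=
  (posSemidef_iff_hermQuad.1 (h.psd k i)).2 v

theorem combo (hx : IsFeasible m x) (hz : IsFeasible m z) {a b : ℝ} (ha : 0 ≤ a) (hb : 0 ≤ b)
    (hab : a + b = 1) : IsFeasible m (a • x + b • z) := by
  refine of_hermQuad (fun k => ?_) (fun k => ?_) (fun k i => ?_) fun k i v => ?_
  · rw [modeResidual_combo, hx.mode k, hz.mode k]; simp
  · rw [powerExcess_combo x z k hab]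
    nlinarith [mul_nonneg ha (neg_nonneg.2 (hx.power k)), mul_nonneg hb (neg_nonneg.2 (hz.power k))]
  · exact ((hx.isHermitian k i).smul (IsSelfAdjoint.all a)).add
      ((hz.isHermitian k i).smul (IsSelfAdjoint.all b))
  · refine le_trans ?_ (le_hermQuad_sensCov_combo x z k i v ha hb hab)
    exact add_nonneg (mul_nonneg ha (hx.hermQuad_sensCov_nonneg k i v))
      (mul_nonneg hb (hz.hermQuad_sensCov_nonneg k i v))

theorem of_tendsto {u : ℕ → Design M} (hu : ∀ t, IsFeasible m (u t))
    (hlim : Tendsto u atTop (𝓝 x)) : IsFeasible m x := by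
  have hQ : ∀ k i, Tendsto (fun t => (u t).2 k i) atTop (𝓝 (x.2 k i)) := fun k i =>
    ((by fun_prop : Continuous fun y : Design M => y.2 k i).tendsto x).comp hlim
  refine of_hermQuad (fun k => ?_) (fun k => ?_) (fun k i => ?_) fun k i v => ?_
  · have h : Continuous fun y : Design M => modeResidual m y k := by
      cases m <;> simp only [modeResidual] <;> fun_prop
    exact tendsto_nhds_unique ((h.tendsto x).comp hlim)
      (tendsto_const_nhds.congr fun t => ((hu t).mode k).symm)
  · have h : Continuous fun y : Design M => powerExcess y k := by
      unfold powerExcess Matrix.trace Matrix.diag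
      fun_prop
    exact le_of_tendsto' ((h.tendsto x).comp hlim) fun t => (hu t).power k
  · exact tendsto_nhds_unique (((by fun_prop :
      Continuous fun Q : Matrix (Fin M) (Fin M) ℂ => Qᴴ).tendsto _).comp (hQ k i))
      ((hQ k i).congr fun t => ((hu t).isHermitian k i).symm)
  · have h : Continuous fun y : Design M => hermQuad v (sensCov y k i) := by
      simp only [hermQuad_sensCov]
      have := (differentiable_hermQuad k i v).continuous
      unfold dotProduct
      fun_prop
    exact ge_of_tendsto' ((h.tendsto x).comp hlim) fun t => (hu t).hermQuad_sensCov_nonneg k i v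

end IsFeasible

/-! ### Monotonicity of the objective and tightness of the surrogates -/

section Objective

variable {M : ℕ} (S : ISACSystem M) {m : DuplexMode} {x y : Design M} {k i : Fin 2}

theorem AuxSign.sum_pos {d : Fin 2 → Fin 2 → ℝ} (h : AuxSign m d) (k : Fin 2) :
    0 < ∑ i, d k i := by
  -- In both modes transceiver k transmits in the half-interval with its own index.
  refine Finset.sum_pos' (fun i _ => (h k i).1) ⟨k, Finset.mem_univ _, (h k k).2 ?_⟩
  cases m <;> simp [Transmits]

theorem ModeConstraint.eq_zero_of_not_transmits (h : ModeConstraint m x) {k i : Fin 2}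
    (hki : ¬ Transmits m k i) : x.2 k i = 0 := by
  cases m
  · simp [Transmits] at hki
  · have : i = k.rev := by
      simp only [Transmits] at hki
      revert hki
      fin_cases k <;> fin_cases i <;> simp [Fin.rev]
    rw [this]
    exact h k

namespace ISACSystem

theorem crbScale_nonneg : 0 ≤ (1 - S.weight) * S.mu / (2 * S.rhoS * S.N) :=
  div_nonneg (mul_nonneg (sub_nonneg.2 S.weight_le_one) S.mu_pos.le)
    (mul_nonneg (mul_nonneg zero_le_two S.rhoS_pos.le) (Nat.cast_nonneg _))

theorem crbScale_pos (h : S.weight < 1) : 0 < (1 - S.weight) * S.mu / (2 * S.rhoS * S.N) := by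
  have h1 := sub_pos.2 h
  have h2 := S.mu_pos
  have h3 := S.rhoS_pos
  have h4 : (0 : ℝ) < S.N := Nat.cast_pos.2 S.N_pos
  positivity

theorem objective_eq_auxObjective :
    S.objective x =
      S.auxObjective (S.sinr x) fun k i => S.sensGain x k i / S.siNoise x k i := by
  simp only [objective, auxObjective, rate, crb, sensInfo, ← Finset.mul_sum]
  ring

/-- At weight 1 the CRB coefficient is zero, so d matters only for `weight < 1`. Positivity of the
smaller sum is essential, since 0⁻¹ = 0 would break the monotonicity of the CRB term. -/
theorem auxObjective_mono {r r' d d' : Fin 2 → Fin 2 → ℝ} (hr : ∀ k i, 0 < 1 + r k i)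
    (hrr : ∀ k i, r k i ≤ r' k i)
    (hd : S.weight < 1 → (∀ k, 0 < ∑ i, d k i) ∧ ∀ k i, d k i ≤ d' k i) :
    S.auxObjective r d ≤ S.auxObjective r' d' := by
  have h1 : S.weight / 2 * ∑ k, ∑ i, Real.logb 2 (1 + r k i) ≤
      S.weight / 2 * ∑ k, ∑ i, Real.logb 2 (1 + r' k i) := by
    refine mul_le_mul_of_nonneg_left ?_ (by linarith [S.weight_nonneg])
    refine Finset.sum_le_sum fun k _ => Finset.sum_le_sum fun i _ => ?_
    exact Real.logb_le_logb_of_le one_lt_two (hr k i) (by linarith [hrr k i])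
  have h2 : (1 - S.weight) * S.mu / (2 * S.rhoS * S.N) * ∑ k, (∑ i, d' k i)⁻¹ ≤
      (1 - S.weight) * S.mu / (2 * S.rhoS * S.N) * ∑ k, (∑ i, d k i)⁻¹ := by
    rcases S.weight_le_one.lt_or_eq with hw | hw
    · refine mul_le_mul_of_nonneg_left (Finset.sum_le_sum fun k _ => ?_) S.crbScale_nonneg
      exact inv_anti₀ ((hd hw).1 k) (Finset.sum_le_sum fun i _ => (hd hw).2 k i)
    · simp [hw]
  unfold auxObjective
  linarith

theorem auxObjective_lt {r d d' : Fin 2 → Fin 2 → ℝ} (hw : S.weight < 1)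
    (hd : ∀ k, 0 < ∑ i, d k i) (hdd : ∀ k i, d k i ≤ d' k i)
    {k₀ i₀ : Fin 2} (h₀ : d k₀ i₀ < d' k₀ i₀) :
    S.auxObjective r d < S.auxObjective r d' := by
  have h : ∑ k, (∑ i, d' k i)⁻¹ < ∑ k, (∑ i, d k i)⁻¹ := by
    refine Finset.sum_lt_sum
      (fun k _ => inv_anti₀ (hd k) (Finset.sum_le_sum fun i _ => hdd k i))
      ⟨k₀, Finset.mem_univ _, ?_⟩
    exact inv_strictAnti₀ (hd k₀)
      (Finset.sum_lt_sum (fun i _ => hdd k₀ i) ⟨i₀, Finset.mem_univ _, h₀⟩)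
  have := mul_lt_mul_of_pos_left h (S.crbScale_pos hw)
  unfold auxObjective
  linarith

theorem tendsto_auxObjective {α : Type*} {l : Filter α} {r d : α → Fin 2 → Fin 2 → ℝ}
    {r' d' : Fin 2 → Fin 2 → ℝ} (hr : ∀ k i, Tendsto (fun t => r t k i) l (𝓝 (r' k i)))
    (hr' : ∀ k i, 1 + r' k i ≠ 0)
    (hd : S.weight < 1 → ∀ k i, Tendsto (fun t => d t k i) l (𝓝 (d' k i)))
    (hd' : S.weight < 1 → ∀ k, ∑ i, d' k i ≠ 0) :
    Tendsto (fun t => S.auxObjective (r t) (d t)) l (𝓝 (S.auxObjective r' d')) := by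
  unfold auxObjective
  refine Tendsto.sub (Tendsto.const_mul _ (tendsto_finsetSum _ fun k _ =>
    tendsto_finsetSum _ fun i _ => ?_)) ?_
  · exact (((hr k i).const_add 1).log (hr' k i)).div_const _
  · rcases S.weight_le_one.lt_or_eq with hw | hw
    · refine Tendsto.const_mul _ (tendsto_finsetSum _ fun k _ => ?_)
      exact (tendsto_finsetSum _ fun i _ => hd hw k i).inv₀ (hd' hw k)
    · simpa [hw] using tendsto_const_nhds

theorem differentiableAt_auxObjective {E : Type*} [NormedAddCommGroup E] [NormedSpace ℝ E]
    {r d : E → Fin 2 → Fin 2 → ℝ} {e : E}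
    (hr : ∀ k i, DifferentiableAt ℝ (fun e => r e k i) e) (hr' : ∀ k i, 1 + r e k i ≠ 0)
    (hd : S.weight < 1 → ∀ k i, DifferentiableAt ℝ (fun e => d e k i) e)
    (hd' : S.weight < 1 → ∀ k, ∑ i, d e k i ≠ 0) :
    DifferentiableAt ℝ (fun e => S.auxObjective (r e) (d e)) e := by
  unfold auxObjective
  refine DifferentiableAt.sub (DifferentiableAt.const_mul
    (DifferentiableAt.fun_sum fun k _ => DifferentiableAt.fun_sum fun i _ => ?_) _) ?_
  · simp only [Real.logb, div_eq_mul_inv]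
    exact (((hr k i).const_add 1).log (hr' k i)).mul_const _
  · rcases S.weight_le_one.lt_or_eq with hw | hw
    · refine DifferentiableAt.const_mul (DifferentiableAt.fun_sum fun k _ => ?_) _
      exact (DifferentiableAt.fun_sum fun i _ => hd hw k i).fun_inv (hd' hw k)
    · simp [hw]

theorem differentiableAt_sinr (h : S.interf x k i ≠ 0) :
    DifferentiableAt ℝ (fun x => S.sinr x k i) x := by
  have h1 := S.differentiable_normSq_signal (M := M) k i
  have h2 := S.differentiable_interf (M := M) k i
  unfold sinr
  fun_prop (disch := assumption)

theorem differentiableAt_objective (hx : IsFeasible m x)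
    (hinfo : S.weight < 1 → ∀ k, 0 < S.sensInfo x k) : DifferentiableAt ℝ S.objective x := by
  have : S.objective = fun x => S.auxObjective (S.sinr x)
      fun k i => S.sensGain x k i / S.siNoise x k i :=
    funext fun x => S.objective_eq_auxObjective
  rw [this]
  refine S.differentiableAt_auxObjective (fun k i => ?_) (fun k i => ?_) (fun hw k i => ?_)
    fun hw k => ?_
  · exact S.differentiableAt_sinr (zero_lt_one.trans_le (hx.one_le_interf S k i)).ne'
  · have := hx.sinr_nonneg S k i
    positivity
  · have h1 := S.differentiable_sensGain (M := M) k i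
    have h2 := S.differentiable_siNoise (M := M) k i
    have h3 : S.siNoise x k i ≠ 0 := (zero_lt_one.trans_le (hx.one_le_siNoise S k i)).ne'
    fun_prop (disch := assumption)
  · exact (hinfo hw k).ne'

theorem sinrSurrogate_eq (y x : Design M) (k i : Fin 2) :
    S.sinrSurrogate y x k i = S.rhoC *
      (2 * (star (S.signal y k i) * S.signal x k i).re / S.interf y k i -
        ‖S.signal y k i‖ ^ 2 / S.interf y k i ^ 2 * S.interf x k i) := by
  rw [sinrSurrogate, norm_div, Complex.norm_real, div_pow, Real.norm_eq_abs, sq_abs]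
  ring

/-- The real part is bounded by the product of the norms; the remaining gap is a square divided by
the interference at x. -/
theorem sinrSurrogate_le (hx : 0 < S.interf x k i) (hy : 0 < S.interf y k i) :
    S.sinrSurrogate y x k i ≤ S.sinr x k i := by
  have hre : (star (S.signal y k i) * S.signal x k i).re ≤
      ‖S.signal y k i‖ * ‖S.signal x k i‖ := by
    refine (Complex.re_le_norm _).trans ?_
    rw [norm_mul, norm_star]
  rw [sinrSurrogate_eq, sinr, mul_div_assoc S.rhoC]
  refine mul_le_mul_of_nonneg_left ?_ S.rhoC_pos.le
  calc _ ≤ 2 * (‖S.signal y k i‖ * ‖S.signal x k i‖) / S.interf y k i -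
        ‖S.signal y k i‖ ^ 2 / S.interf y k i ^ 2 * S.interf x k i := by gcongr
    _ ≤ ‖S.signal x k i‖ ^ 2 / S.interf x k i := by
      rw [← sub_nonneg]
      have : ‖S.signal x k i‖ ^ 2 / S.interf x k i -
          (2 * (‖S.signal y k i‖ * ‖S.signal x k i‖) / S.interf y k i -
            ‖S.signal y k i‖ ^ 2 / S.interf y k i ^ 2 * S.interf x k i) =
          (‖S.signal x k i‖ - ‖S.signal y k i‖ / S.interf y k i * S.interf x k i) ^ 2 /
            S.interf x k i := by
        field_simp
        ring
      rw [this]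
      positivity

theorem sinrSurrogate_self (h : 0 < S.interf y k i) :
    S.sinrSurrogate y y k i = S.sinr y k i := by
  have : (star (S.signal y k i) * S.signal y k i).re = ‖S.signal y k i‖ ^ 2 := by
    rw [← Complex.normSq_eq_norm_sq, Complex.normSq_apply]
    simp
  rw [sinrSurrogate_eq, sinr, this]
  field_simp
  ring

/-- The gap is (g - cB)²/B for any coefficient c, so nothing is required of the base point. -/
theorem sensSurrogate_le {gy g : Fin 2 → Fin 2 → ℝ} (hx : 0 < S.siNoise x k i) :
    S.sensSurrogate y gy x g k i ≤ g k i ^ 2 / S.siNoise x k i := by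
  rw [sensSurrogate, ← sub_nonneg, mul_div_assoc 2]
  generalize gy k i / S.siNoise y k i = c
  have : g k i ^ 2 / S.siNoise x k i - (2 * c * g k i - c ^ 2 * S.siNoise x k i) =
      (g k i - c * S.siNoise x k i) ^ 2 / S.siNoise x k i := by
    have := hx.ne'
    field_simp
    ring
  rw [this]
  positivity

theorem sensSurrogate_self {g : Fin 2 → Fin 2 → ℝ} (hy : 0 < S.siNoise y k i) :
    S.sensSurrogate y g y g k i = g k i ^ 2 / S.siNoise y k i := by
  rw [sensSurrogate]
  field_simp
  ring

end ISACSystem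

end Objective

/-! ### Monotone ascent and positivity of the limiting Fisher information -/

namespace ISACSystem

variable {M : ℕ} {S : ISACSystem M} {m : DuplexMode}

namespace IsSCARun

variable {x : ℕ → Design M} {g : ℕ → Fin 2 → Fin 2 → ℝ}

theorem feasible (h : S.IsSCARun m x g) (t : ℕ) : IsFeasible m (x t) := by
  cases t with
  | zero => exact h.init_feasible
  | succ t =>
    obtain ⟨r, d, hp, -⟩ := h.step t
    exact ⟨hp.mode, hp.power, fun k i => (posSemidef_schurBlock_iff _ k i).1 (hp.schur k i)⟩

theorem auxSign (h : S.IsSCARun m x g) (t : ℕ) : AuxSign m (g t) := by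
  cases t with
  | zero => exact h.init_sign
  | succ t =>
    obtain ⟨r, d, hp, -⟩ := h.step t
    exact hp.g_sign

theorem sq_le_sensGain (h : S.IsSCARun m x g) (t : ℕ) (k i : Fin 2) :
    g t k i ^ 2 ≤ S.sensGain (x t) k i := by
  cases t with
  | zero => exact h.init_gain k i
  | succ t =>
    obtain ⟨r, d, hp, -⟩ := h.step t
    exact hp.gain k i

theorem eq_zero_of_not_transmits (h : S.IsSCARun m x g) (t : ℕ) {k i : Fin 2}
    (hki : ¬ Transmits m k i) : g t k i = 0 := by
  have h1 := h.sq_le_sensGain t k i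
  rw [sensGain, (h.feasible t).mode.eq_zero_of_not_transmits hki, hermQuad_zero, mul_zero] at h1
  exact pow_eq_zero_iff two_ne_zero |>.1 (le_antisymm h1 (sq_nonneg _))

end IsSCARun

/-- The bound is the value that the new iterate contributes, as a feasible point, to the next
subproblem; this links consecutive optimal values. -/
theorem SubFeasible.auxObjective_le {y : Design M} {gy : Fin 2 → Fin 2 → ℝ} {p : SubPoint M}
    (h : S.SubFeasible m y gy p) (hy : IsFeasible m y) :
    S.auxObjective p.r p.d ≤
      S.auxObjective (S.sinr p.x) fun k i => p.g k i ^ 2 / S.siNoise p.x k i := by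
  have hx : IsFeasible m p.x :=
    ⟨h.mode, h.power, fun k i => (posSemidef_schurBlock_iff _ k i).1 (h.schur k i)⟩
  refine S.auxObjective_mono (fun k i => by linarith [h.r_nonneg k i]) (fun k i => ?_)
    fun _ => ⟨h.d_sign.sum_pos, fun k i => ?_⟩
  · exact (h.sinr k i).trans (S.sinrSurrogate_le
      (zero_lt_one.trans_le (hx.one_le_interf S k i))
      (zero_lt_one.trans_le (hy.one_le_interf S k i)))
  · exact (h.sens k i).trans (S.sensSurrogate_le (zero_lt_one.trans_le (hx.one_le_siNoise S k i)))

namespace IsSCARun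

variable {x : ℕ → Design M} {g : ℕ → Fin 2 → Fin 2 → ℝ}

theorem sq_div_sign (h : S.IsSCARun m x g) (t : ℕ) :
    AuxSign m fun k i => g t k i ^ 2 / S.siNoise (x t) k i := fun k i => by
  have h1 := zero_lt_one.trans_le ((h.feasible t).one_le_siNoise S k i)
  refine ⟨by positivity, fun hki => ?_⟩
  have := (h.auxSign t k i).2 hki
  positivity

/-- Both surrogates are exact at their base point. -/
theorem subFeasible_self (h : S.IsSCARun m x g) (t : ℕ) :
    S.SubFeasible m (x t) (g t)
      ⟨x t, S.sinr (x t), g t, fun k i => g t k i ^ 2 / S.siNoise (x t) k i⟩ where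
  r_nonneg := (h.feasible t).sinr_nonneg S
  g_sign := h.auxSign t
  d_sign := h.sq_div_sign t
  sinr k i := (S.sinrSurrogate_self
    (zero_lt_one.trans_le ((h.feasible t).one_le_interf S k i))).ge
  gain := h.sq_le_sensGain t
  sens k i := (S.sensSurrogate_self
    (zero_lt_one.trans_le ((h.feasible t).one_le_siNoise S k i))).ge
  mode := (h.feasible t).mode
  power := (h.feasible t).power
  schur k i := (posSemidef_schurBlock_iff _ k i).2 ((h.feasible t).psd k i)

theorem auxObjective_sq_div_le_objective (h : S.IsSCARun m x g) (t : ℕ) :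
    S.auxObjective (S.sinr (x t)) (fun k i => g t k i ^ 2 / S.siNoise (x t) k i) ≤
      S.objective (x t) := by
  rw [objective_eq_auxObjective]
  refine S.auxObjective_mono (fun k i => ?_) (fun _ _ => le_rfl)
    fun _ => ⟨(h.sq_div_sign t).sum_pos, fun k i => ?_⟩
  · linarith [(h.feasible t).sinr_nonneg S k i]
  · have h1 := zero_lt_one.trans_le ((h.feasible t).one_le_siNoise S k i)
    have h2 := h.sq_le_sensGain t k i
    gcongr

/-- The next iterate is at least as good as any feasible point of the current subproblem. -/
theorem auxObjective_le_objective_succ (h : S.IsSCARun m x g) (t : ℕ) {q : SubPoint M}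
    (hq : S.SubFeasible m (x t) (g t) q) : S.auxObjective q.r q.d ≤ S.objective (x (t + 1)) := by
  obtain ⟨r, d, hp, hmax⟩ := h.step t
  exact (hmax q hq).trans ((hp.auxObjective_le (h.feasible t)).trans
    (h.auxObjective_sq_div_le_objective (t + 1)))

/-- The optimal value of the first subproblem serves as v, since optimal values are nondecreasing
and each is dominated by the objective at the new iterate. -/
theorem exists_le_objective (h : S.IsSCARun m x g) : ∃ v : ℝ, ∀ t, v ≤ S.objective (x (t + 1)) := by
  obtain ⟨r₀, d₀, h₀⟩ := h.step 0
  have key : ∀ t, ∃ r d, S.SubSolution m (x t) (g t) ⟨x (t + 1), r, g (t + 1), d⟩ ∧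
      S.auxObjective r₀ d₀ ≤ S.auxObjective r d := by
    intro t
    induction t with
    | zero => exact ⟨r₀, d₀, h₀, le_rfl⟩
    | succ t ih =>
      obtain ⟨r, d, hp, hle⟩ := ih
      obtain ⟨r', d', hp'⟩ := h.step (t + 1)
      have h1 := hp.1.auxObjective_le (h.feasible t)
      have h2 := hp'.2 _ (h.subFeasible_self (t + 1))
      dsimp only at h1 h2
      exact ⟨r', d', hp', hle.trans (h1.trans h2)⟩
  refine ⟨S.auxObjective r₀ d₀, fun t => ?_⟩
  obtain ⟨r, d, hp, hle⟩ := key t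
  have h1 := h.auxObjective_le_objective_succ t hp.1
  dsimp only at h1
  exact hle.trans h1

theorem sensInfo_pos (h : S.IsSCARun m x g) (t : ℕ) (k : Fin 2) : 0 < S.sensInfo (x t) k := by
  refine ((h.sq_div_sign t).sum_pos k).trans_le (Finset.sum_le_sum fun i _ => ?_)
  have h1 := zero_lt_one.trans_le ((h.feasible t).one_le_siNoise S k i)
  have h2 := h.sq_le_sensGain t k i
  gcongr

/-- For `weight < 1` the gain constraint is active at the iterates. -/
theorem eq_sqrt_sensGain (h : S.IsSCARun m x g) (hw : S.weight < 1) (t : ℕ) (k i : Fin 2) :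
    g (t + 1) k i = √(S.sensGain (x (t + 1)) k i) := by
  have hx := h.feasible (t + 1)
  have hle : ∀ k i, g (t + 1) k i ≤ √(S.sensGain (x (t + 1)) k i) := fun k i =>
    Real.le_sqrt_of_sq_le (h.sq_le_sensGain (t + 1) k i)
  by_cases hki : Transmits m k i
  swap
  · rw [h.eq_zero_of_not_transmits _ hki, sensGain, hx.mode.eq_zero_of_not_transmits hki,
      hermQuad_zero, mul_zero, Real.sqrt_zero]
  by_contra hne
  have hlt := lt_of_le_of_ne (hle k i) hne
  obtain ⟨r, d, hp, hmax⟩ := h.step t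
  -- Raising g to its upper bound keeps the point admissible and strictly raises the surrogate at
  -- (k, i), where its coefficient 2g/B is positive. This contradicts optimality.
  set γ : Fin 2 → Fin 2 → ℝ := fun k i => √(S.sensGain (x (t + 1)) k i) with hγ
  have hcoef : ∀ k i, 0 ≤ 2 * g t k i / S.siNoise (x t) k i := fun k i => by
    have h1 := zero_lt_one.trans_le ((h.feasible t).one_le_siNoise S k i)
    have h2 := (h.auxSign t k i).1
    positivity
  have hdd : ∀ k i, d k i ≤ S.sensSurrogate (x t) (g t) (x (t + 1)) γ k i := fun k i =>
    (hp.sens k i).trans (sub_le_sub_right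
      (mul_le_mul_of_nonneg_left (hle k i) (hcoef k i)) _)
  have hq : S.SubFeasible m (x t) (g t)
      ⟨x (t + 1), r, γ, S.sensSurrogate (x t) (g t) (x (t + 1)) γ⟩ :=
    { r_nonneg := hp.r_nonneg
      g_sign := fun k i => ⟨Real.sqrt_nonneg _, fun hki =>
        ((h.auxSign (t + 1) k i).2 hki).trans_le (hle k i)⟩
      d_sign := fun k i => ⟨(hp.d_sign k i).1.trans (hdd k i), fun hki =>
        ((hp.d_sign k i).2 hki).trans_le (hdd k i)⟩
      sinr := hp.sinr
      gain := fun k i => (Real.sq_sqrt (hx.sensGain_nonneg S k i)).le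
      sens := fun _ _ => le_rfl
      mode := hp.mode
      power := hp.power
      schur := hp.schur }
  refine absurd (hmax _ hq) (not_le.2 (S.auxObjective_lt hw hp.d_sign.sum_pos hdd
    (k₀ := k) (i₀ := i) ((hp.sens k i).trans_lt (sub_lt_sub_right
      (mul_lt_mul_of_pos_left hlt ?_) _))))
  have h1 := zero_lt_one.trans_le ((h.feasible t).one_le_siNoise S k i)
  have h2 := (h.auxSign t k i).2 hki
  positivity

end IsSCARun

theorem continuousAt_sensInfo {y : Design M} (hy : IsFeasible m y) (k : Fin 2) :
    ContinuousAt (fun x => S.sensInfo x k) y :=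
  tendsto_finsetSum _ fun i _ => ((S.differentiable_sensGain k i).continuous.tendsto y).div
    ((S.differentiable_siNoise k i).continuous.tendsto y)
    (zero_lt_one.trans_le (hy.one_le_siNoise S k i)).ne'

theorem continuousAt_rate {y : Design M} (hy : IsFeasible m y) (k : Fin 2) :
    ContinuousAt (fun x => S.rate x k) y := by
  refine Tendsto.const_mul _ (tendsto_finsetSum _ fun i _ => Tendsto.div_const ?_ _)
  have h := hy.sinr_nonneg S k i
  exact ((S.differentiableAt_sinr
    (zero_lt_one.trans_le (hy.one_le_interf S k i)).ne').continuousAt.tendsto.const_add 1).log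
      (by positivity)

/-- The objective is bounded below along the run while the rate part converges, so the inverse
information is eventually bounded by a constant K, and the information itself by K⁻¹ from below. -/
theorem IsSCARun.sensInfo_limit_pos {x : ℕ → Design M} {g : ℕ → Fin 2 → Fin 2 → ℝ}
    (h : S.IsSCARun m x g) {xlim : Design M} (hlim : Tendsto x atTop (𝓝 xlim))
    (hw : S.weight < 1) (k : Fin 2) : 0 < S.sensInfo xlim k := by
  have hfeas := IsFeasible.of_tendsto h.feasible hlim
  obtain ⟨v, hv⟩ := h.exists_le_objective
  have hlim' := (tendsto_add_atTop_iff_nat 1).2 hlim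
  have hrate : Tendsto (fun t => S.weight * ∑ k, S.rate (x (t + 1)) k) atTop
      (𝓝 (S.weight * ∑ k, S.rate xlim k)) :=
    Tendsto.const_mul _ (tendsto_finsetSum _ fun k _ => (continuousAt_rate hfeas k).tendsto.comp hlim')
  set c := (1 - S.weight) * S.mu / (2 * S.rhoS * S.N) with hc
  have hcpos : 0 < c := S.crbScale_pos hw
  set K := (S.weight * ∑ k, S.rate xlim k + 1 - v) / c with hK
  have hinv : ∀ᶠ t in atTop, (S.sensInfo (x (t + 1)) k)⁻¹ ≤ K := by
    filter_upwards [hrate.eventually_lt_const (lt_add_one _)] with t ht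
    have h1 : S.objective (x (t + 1)) = S.weight * ∑ k, S.rate (x (t + 1)) k -
        c * ∑ k, (S.sensInfo (x (t + 1)) k)⁻¹ := by
      simp only [objective, crb, ← Finset.mul_sum, hc]
      ring
    have h2 : (S.sensInfo (x (t + 1)) k)⁻¹ ≤ ∑ k, (S.sensInfo (x (t + 1)) k)⁻¹ :=
      Finset.single_le_sum (f := fun k => (S.sensInfo (x (t + 1)) k)⁻¹)
        (fun k _ => inv_nonneg.2 (h.sensInfo_pos (t + 1) k).le) (Finset.mem_univ k)
    have h3 := hv t
    rw [hK, le_div_iff₀ hcpos]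
    nlinarith [mul_le_mul_of_nonneg_left h2 hcpos.le]
  have hKpos : 0 < K := by
    obtain ⟨t, ht⟩ := hinv.exists
    exact (inv_pos.2 (h.sensInfo_pos (t + 1) k)).trans_le ht
  have hge : ∀ᶠ t in atTop, K⁻¹ ≤ S.sensInfo (x (t + 1)) k := by
    filter_upwards [hinv] with t ht
    exact inv_le_of_inv_le₀ (h.sensInfo_pos (t + 1) k) ht
  exact (inv_pos.2 hKpos).trans_le
    (ge_of_tendsto ((continuousAt_sensInfo hfeas k).tendsto.comp hlim') hge)

end ISACSystem

/-! ### Regularity of the surrogate objective and its tangency to the objective -/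

namespace ISACSystem

variable {M : ℕ} {S : ISACSystem M} {m : DuplexMode}

theorem differentiable_sinrSurrogate (y : Design M) (k i : Fin 2) :
    Differentiable ℝ fun x => S.sinrSurrogate y x k i := by
  have h1 := S.differentiable_signal (M := M) k i
  have h2 := S.differentiable_interf (M := M) k i
  have h3 : Differentiable ℝ fun x => (star (S.signal y k i) * S.signal x k i).re :=
    Complex.reCLM.differentiable.comp (h1.const_mul _)
  simp only [sinrSurrogate, div_eq_mul_inv]
  fun_prop

theorem continuous_sensSurrogate (y : Design M) (gy : Fin 2 → Fin 2 → ℝ) (k i : Fin 2) :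
    Continuous fun x => S.sensSurrogate y gy x (fun k i => √(S.sensGain x k i)) k i := by
  have h1 := (S.differentiable_sensGain k i).continuous
  have h2 := (S.differentiable_siNoise k i).continuous
  unfold sensSurrogate
  fun_prop

theorem tendsto_sinrSurrogate {u v : ℕ → Design M} {y x : Design M}
    (hu : Tendsto u atTop (𝓝 y)) (hv : Tendsto v atTop (𝓝 x)) (k i : Fin 2)
    (hy : S.interf y k i ≠ 0) :
    Tendsto (fun t => S.sinrSurrogate (u t) (v t) k i) atTop (𝓝 (S.sinrSurrogate y x k i)) := by
  have h1 := (S.differentiable_signal k i).continuous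
  have h2 := (S.differentiable_interf k i).continuous
  have hsu := (h1.tendsto y).comp hu
  have hsv := (h1.tendsto x).comp hv
  have hIu := (h2.tendsto y).comp hu
  have hIv := (h2.tendsto x).comp hv
  have hre := (Complex.continuous_re.tendsto _).comp (hsu.star.mul hsv)
  simp only [sinrSurrogate_eq]
  exact (((hre.const_mul 2).div hIu hy).sub
    (((hsu.norm.pow 2).div (hIu.pow 2) (pow_ne_zero 2 hy)).mul hIv)).const_mul _

theorem tendsto_sensSurrogate {u v : ℕ → Design M} {y x : Design M} {g : ℕ → Fin 2 → Fin 2 → ℝ}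
    {gy : Fin 2 → Fin 2 → ℝ} (hu : Tendsto u atTop (𝓝 y)) (hv : Tendsto v atTop (𝓝 x))
    (k i : Fin 2) (hg : Tendsto (fun t => g t k i) atTop (𝓝 (gy k i)))
    (hy : S.siNoise y k i ≠ 0) :
    Tendsto (fun t => S.sensSurrogate (u t) (g t) (v t)
      (fun k i => √(S.sensGain (v t) k i)) k i) atTop
      (𝓝 (S.sensSurrogate y gy x (fun k i => √(S.sensGain x k i)) k i)) := by
  have h1 := (S.differentiable_sensGain k i).continuous
  have h2 := (S.differentiable_siNoise k i).continuous
  have hG := ((h1.tendsto x).comp hv).sqrt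
  have hBu := (h2.tendsto y).comp hu
  have hBv := (h2.tendsto x).comp hv
  exact (((hg.const_mul 2).div hBu hy).mul hG).sub (((hg.div hBu hy).pow 2).mul hBv)

variable (S) in
/-- The surrogate objective at `x` built at `y`, with all auxiliary variables at their
upper bounds. -/
def surrogateObjective (y x : Design M) : ℝ :=
  S.auxObjective (S.sinrSurrogate y x)
    (S.sensSurrogate y (fun k i => √(S.sensGain y k i)) x fun k i => √(S.sensGain x k i))

theorem sensSurrogate_sqrt_self {y : Design M} (hy : IsFeasible m y) (k i : Fin 2) :
    S.sensSurrogate y (fun k i => √(S.sensGain y k i)) y (fun k i => √(S.sensGain y k i)) k i =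
      S.sensGain y k i / S.siNoise y k i := by
  rw [sensSurrogate_self S (zero_lt_one.trans_le (hy.one_le_siNoise S k i)),
    Real.sq_sqrt (hy.sensGain_nonneg S k i)]

theorem surrogateObjective_self {y : Design M} (hy : IsFeasible m y) :
    S.surrogateObjective y y = S.objective y := by
  rw [objective_eq_auxObjective, surrogateObjective]
  congr 1
  · funext k i
    exact S.sinrSurrogate_self (zero_lt_one.trans_le (hy.one_le_interf S k i))
  · funext k i
    exact sensSurrogate_sqrt_self hy k i

theorem one_add_sinrSurrogate_self_pos {y : Design M} (hy : IsFeasible m y) (k i : Fin 2) :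
    0 < 1 + S.sinrSurrogate y y k i := by
  rw [S.sinrSurrogate_self (zero_lt_one.trans_le (hy.one_le_interf S k i))]
  linarith [hy.sinr_nonneg S k i]

theorem sum_sensSurrogate_sqrt_self {y : Design M} (hy : IsFeasible m y) (k : Fin 2) :
    ∑ i, S.sensSurrogate y (fun k i => √(S.sensGain y k i)) y
      (fun k i => √(S.sensGain y k i)) k i = S.sensInfo y k :=
  Finset.sum_congr rfl fun i _ => sensSurrogate_sqrt_self hy k i

theorem differentiableAt_surrogateObjective {y : Design M} (hy : IsFeasible m y)
    (hinfo : S.weight < 1 → ∀ k, 0 < S.sensInfo y k) :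
    DifferentiableAt ℝ (S.surrogateObjective y) y := by
  refine S.differentiableAt_auxObjective (fun k i => differentiable_sinrSurrogate y k i y)
    (fun k i => (one_add_sinrSurrogate_self_pos hy k i).ne') (fun _ k i => ?_) fun hw k => ?_
  · have h1 := S.differentiable_sensGain (M := M) k i
    have h2 := S.differentiable_siNoise (M := M) k i
    -- The square root is not differentiable at 0, but its coefficient is then also √0 and the
    -- surrogate vanishes identically. This occurs in idle half-intervals.
    by_cases hG : S.sensGain y k i = 0
    · simp only [sensSurrogate, hG, Real.sqrt_zero, mul_zero, zero_div, zero_mul, ne_eq,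
        OfNat.ofNat_ne_zero, not_false_eq_true, zero_pow, sub_zero]
      fun_prop
    · have h3 : DifferentiableAt ℝ (fun x => √(S.sensGain x k i)) y := (h1 y).sqrt hG
      unfold sensSurrogate
      fun_prop
  · rw [sum_sensSurrogate_sqrt_self hy]
    exact (hinfo hw k).ne'

/-- In full duplex the two half-intervals carry the same Q, in half duplex only one is active.
Either way, if one active gain vanished, the whole information would. -/
theorem sensGain_pos_of_transmits {y : Design M} (hy : IsFeasible m y) {k i : Fin 2}
    (hinfo : 0 < S.sensInfo y k) (hki : Transmits m k i) : 0 < S.sensGain y k i := by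
  refine lt_of_le_of_ne (hy.sensGain_nonneg S k i) fun h0 => hinfo.ne' ?_
  refine Finset.sum_eq_zero fun j _ => ?_
  suffices h : S.sensGain y k j = 0 by rw [h, zero_div]
  by_cases hj : j = i
  · rw [hj, ← h0]
  cases m
  · have h01 : y.2 k 0 = y.2 k 1 := sub_eq_zero.1 (hy.mode k)
    have hij : y.2 k j = y.2 k i := by
      revert hj
      fin_cases i <;> fin_cases j <;> simp [h01]
    rw [sensGain, hij]
    exact h0.symm
  · have : ¬ Transmits DuplexMode.half k j := fun h => hj (h.trans hki.symm)
    rw [sensGain, hy.mode.eq_zero_of_not_transmits this, hermQuad_zero, mul_zero]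

/-- The path from `y` to `z`. -/
def segmentPath (y z : Design M) (ε : ℝ) : Design M := (1 - ε) • y + ε • z

theorem segmentPath_zero (y z : Design M) : segmentPath y z 0 = y := by
  simp [segmentPath]

theorem hasDerivAt_segmentPath (y z : Design M) : HasDerivAt (segmentPath y z) (z - y) 0 := by
  have h := (((hasDerivAt_id (0 : ℝ)).const_sub 1).smul_const y).add
    ((hasDerivAt_id (0 : ℝ)).smul_const z)
  have h' : (-1 : ℝ) • y + (1 : ℝ) • z = z - y := by
    rw [neg_one_smul, one_smul, sub_eq_add_neg, add_comm]
  rw [← h']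
  exact h

theorem tendsto_segmentPath (y z : Design M) : Tendsto (segmentPath y z) (𝓝 0) (𝓝 y) := by
  have := (hasDerivAt_segmentPath y z).continuousAt.tendsto
  rwa [segmentPath_zero] at this

/-- The neighbourhood is two-sided, so that tangency can be read off from a local minimum. For ε < 0
the path may leave the feasible set, so the signs needed come from continuity at y. -/
theorem eventually_surrogateObjective_le {y z : Design M} (hy : IsFeasible m y)
    (hz : IsFeasible m z) (hinfo : S.weight < 1 → ∀ k, 0 < S.sensInfo y k) :
    ∀ᶠ ε in 𝓝 0, S.surrogateObjective y (segmentPath y z ε) ≤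
      S.objective (segmentPath y z ε) := by
  have hpath := tendsto_segmentPath y z
  have hI : ∀ᶠ ε in 𝓝 0, ∀ k i, 0 < S.interf (segmentPath y z ε) k i :=
    eventually_all.2 fun k => eventually_all.2 fun i =>
      (((S.differentiable_interf k i).continuous.tendsto y).comp hpath).eventually_const_lt
        (zero_lt_one.trans_le (hy.one_le_interf S k i))
  have hB : ∀ᶠ ε in 𝓝 0, ∀ k i, 0 < S.siNoise (segmentPath y z ε) k i :=
    eventually_all.2 fun k => eventually_all.2 fun i =>
      (((S.differentiable_siNoise k i).continuous.tendsto y).comp hpath).eventually_const_lt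
        (zero_lt_one.trans_le (hy.one_le_siNoise S k i))
  have hr : ∀ᶠ ε in 𝓝 0, ∀ k i, 0 < 1 + S.sinrSurrogate y (segmentPath y z ε) k i :=
    eventually_all.2 fun k => eventually_all.2 fun i =>
      ((((differentiable_sinrSurrogate y k i).continuous.tendsto y).comp
        hpath).const_add 1).eventually_const_lt (one_add_sinrSurrogate_self_pos hy k i)
  have hd : ∀ᶠ ε in 𝓝 0, S.weight < 1 → ∀ k, 0 < ∑ i, S.sensSurrogate y
      (fun k i => √(S.sensGain y k i)) (segmentPath y z ε)
      (fun k i => √(S.sensGain (segmentPath y z ε) k i)) k i := by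
    refine eventually_all.2 fun hw => eventually_all.2 fun k => ?_
    have h := tendsto_finsetSum Finset.univ fun i _ => ((continuous_sensSurrogate (S := S) y
      (fun k i => √(S.sensGain y k i)) k i).tendsto y).comp hpath
    rw [sum_sensSurrogate_sqrt_self hy] at h
    exact h.eventually_const_lt (hinfo hw k)
  have hG : ∀ᶠ ε in 𝓝 0, S.weight < 1 → ∀ k i, 0 ≤ S.sensGain (segmentPath y z ε) k i := by
    refine eventually_all.2 fun hw => eventually_all.2 fun k => eventually_all.2 fun i => ?_
    by_cases hki : Transmits m k i
    · exact ((((S.differentiable_sensGain k i).continuous.tendsto y).comp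
        hpath).eventually_const_lt (sensGain_pos_of_transmits hy (hinfo hw k) hki)).mono
          fun _ h => h.le
    · refine Eventually.of_forall fun ε => ?_
      rw [segmentPath, sensGain_combo, sensGain, sensGain,
        hy.mode.eq_zero_of_not_transmits hki, hz.mode.eq_zero_of_not_transmits hki, hermQuad_zero]
      simp
  filter_upwards [hI, hB, hr, hd, hG] with ε hI hB hr hd hG
  rw [objective_eq_auxObjective]
  refine S.auxObjective_mono hr (fun k i => S.sinrSurrogate_le (hI k i)
    (zero_lt_one.trans_le (hy.one_le_interf S k i))) fun hw => ⟨hd hw, fun k i => ?_⟩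
  refine (S.sensSurrogate_le (hB k i)).trans_eq ?_
  rw [Real.sq_sqrt (hG hw k i)]

/-! ### Passage to the limit in the optimality of the subproblems -/

namespace IsSCARun

variable {x : ℕ → Design M} {g : ℕ → Fin 2 → Fin 2 → ℝ} {xlim : Design M}

/-- For a fixed ε, the mixture of x t and z competes in subproblem t for all large t. Its surrogate
value and the objective at x (t + 1) both converge. -/
theorem surrogateObjective_le_objective (h : S.IsSCARun m x g)
    (hlim : Tendsto x atTop (𝓝 xlim)) {z : Design M} (hz : IsFeasible m z)
    (hsig : ∀ k i, S.signal xlim k i = 0 → S.signal z k i = 0) {ε : ℝ} (hε₀ : 0 < ε)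
    (hε₁ : ε < 1) (hB : ∀ k i, ε * S.siNoise z k i < 1 - ε)
    (hI : ∀ k i, ε * S.interf z k i < 1 - ε)
    (hr : ∀ k i, S.signal xlim k i ≠ 0 → 0 < S.sinrSurrogate xlim (segmentPath xlim z ε) k i)
    (hd : S.weight < 1 → ∀ k, 0 < ∑ i, S.sensSurrogate xlim
      (fun k i => √(S.sensGain xlim k i)) (segmentPath xlim z ε)
      (fun k i => √(S.sensGain (segmentPath xlim z ε) k i)) k i) :
    S.surrogateObjective xlim (segmentPath xlim z ε) ≤ S.objective xlim := by
  have hfeas := IsFeasible.of_tendsto h.feasible hlim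
  have hε : 0 < 1 - ε := by linarith
  have hX : Tendsto (fun t => segmentPath (x t) z ε) atTop (𝓝 (segmentPath xlim z ε)) :=
    (hlim.const_smul (1 - ε)).add_const (ε • z)
  have hXfeas : ∀ t, IsFeasible m (segmentPath (x t) z ε) := fun t =>
    (h.feasible t).combo hz hε.le hε₀.le (by ring)
  have hsinr : ∀ k i, Tendsto (fun t => S.sinrSurrogate (x t) (segmentPath (x t) z ε) k i) atTop
      (𝓝 (S.sinrSurrogate xlim (segmentPath xlim z ε) k i)) := fun k i =>
    tendsto_sinrSurrogate hlim hX k i (zero_lt_one.trans_le (hfeas.one_le_interf S k i)).ne'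
  -- Where the limiting signal vanishes, continuity gives no strict sign. As z adds no signal there,
  -- the surrogate is an explicit nonnegative multiple of (1-ε)I_t - εI_z.
  have hidle : ∀ t k i, S.signal xlim k i = 0 →
      0 ≤ S.sinrSurrogate (x t) (segmentPath (x t) z ε) k i := fun t k i h0 => by
    have hI1 := (h.feasible t).one_le_interf S k i
    have hre : (star (S.signal (x t) k i) * S.signal (segmentPath (x t) z ε) k i).re =
        (1 - ε) * ‖S.signal (x t) k i‖ ^ 2 := by
      rw [segmentPath, signal_combo, hsig k i h0, ← Complex.normSq_eq_norm_sq,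
        Complex.normSq_apply]
      simp
      ring
    rw [sinrSurrogate_eq, hre, segmentPath, interf_combo S _ _ k i (by ring)]
    refine mul_nonneg S.rhoC_pos.le ?_
    have hpos : 0 < S.interf (x t) k i := by linarith
    have : 2 * ((1 - ε) * ‖S.signal (x t) k i‖ ^ 2) / S.interf (x t) k i -
        ‖S.signal (x t) k i‖ ^ 2 / S.interf (x t) k i ^ 2 *
          ((1 - ε) * S.interf (x t) k i + ε * S.interf z k i) =
        ‖S.signal (x t) k i‖ ^ 2 / S.interf (x t) k i ^ 2 *
          ((1 - ε) * S.interf (x t) k i - ε * S.interf z k i) := by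
      field_simp
      ring
    rw [this]
    refine mul_nonneg (by positivity) ?_
    nlinarith [hI k i]
  have hr' : ∀ k i, 0 ≤ S.sinrSurrogate xlim (segmentPath xlim z ε) k i := fun k i => by
    by_cases h0 : S.signal xlim k i = 0
    · exact ge_of_tendsto' (hsinr k i) fun t => hidle t k i h0
    · exact (hr k i h0).le
  have hr_ev : ∀ᶠ t in atTop, ∀ k i,
      0 ≤ S.sinrSurrogate (x t) (segmentPath (x t) z ε) k i := by
    refine eventually_all.2 fun k => eventually_all.2 fun i => ?_
    by_cases h0 : S.signal xlim k i = 0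
    · exact Eventually.of_forall fun t => hidle t k i h0
    · exact ((hsinr k i).eventually_const_lt (hr k i h0)).mono fun _ h => h.le
  -- This is shown for every t without a limit, since g t need not converge at weight 1. With c =
  -- g/B at x t, the mixture has gain root at least (1-ε)g and noise below 2(1-ε)B, whence c(2√G -
  -- cB) > 0.
  have hsens : ∀ t, AuxSign m (S.sensSurrogate (x t) (g t) (segmentPath (x t) z ε)
      fun k i => √(S.sensGain (segmentPath (x t) z ε) k i)) := fun t k i => by
    have hpos : Transmits m k i → 0 < S.sensSurrogate (x t) (g t) (segmentPath (x t) z ε)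
        (fun k i => √(S.sensGain (segmentPath (x t) z ε) k i)) k i := fun hki => by
      have hg := (h.auxSign t k i).2 hki
      have hB1 := (h.feasible t).one_le_siNoise S k i
      have hBpos : 0 < S.siNoise (x t) k i := by linarith
      have hsqrt : (1 - ε) * g t k i ≤ √(S.sensGain (segmentPath (x t) z ε) k i) := by
        refine Real.le_sqrt_of_sq_le ?_
        rw [segmentPath, sensGain_combo]
        have h1 := mul_le_mul_of_nonneg_left (h.sq_le_sensGain t k i) hε.le
        have h2 := mul_nonneg hε₀.le (hz.sensGain_nonneg S k i)
        nlinarith [mul_nonneg (mul_nonneg hε.le hε₀.le) (sq_nonneg (g t k i))]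
      have hnoise : S.siNoise (segmentPath (x t) z ε) k i <
          2 * (1 - ε) * S.siNoise (x t) k i := by
        rw [segmentPath, siNoise_combo S _ _ k i (by ring)]
        nlinarith [hB k i]
      have hc : 0 < g t k i / S.siNoise (x t) k i := by positivity
      rw [sensSurrogate, mul_div_assoc]
      have hgB : g t k i = g t k i / S.siNoise (x t) k i * S.siNoise (x t) k i := by
        field_simp
      generalize g t k i / S.siNoise (x t) k i = c at *
      rw [hgB] at hsqrt
      nlinarith [mul_le_mul_of_nonneg_left hsqrt hc.le,
        mul_lt_mul_of_pos_left hnoise (mul_pos hc hc)]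
    refine ⟨?_, hpos⟩
    by_cases hki : Transmits m k i
    · exact (hpos hki).le
    · simp [sensSurrogate, h.eq_zero_of_not_transmits t hki]
  have hsub : ∀ᶠ t in atTop, S.SubFeasible m (x t) (g t) ⟨segmentPath (x t) z ε,
      S.sinrSurrogate (x t) (segmentPath (x t) z ε),
      fun k i => √(S.sensGain (segmentPath (x t) z ε) k i),
      S.sensSurrogate (x t) (g t) (segmentPath (x t) z ε)
        fun k i => √(S.sensGain (segmentPath (x t) z ε) k i)⟩ := by
    filter_upwards [hr_ev] with t ht
    exact
      { r_nonneg := ht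
        g_sign := fun k i => ⟨Real.sqrt_nonneg _, fun hki => by
          have hg := (h.auxSign t k i).2 hki
          have h1 := h.sq_le_sensGain t k i
          have h2 := hz.sensGain_nonneg S k i
          refine Real.sqrt_pos.2 ?_
          rw [segmentPath, sensGain_combo]
          have h3 : 0 < S.sensGain (x t) k i := (by positivity : 0 < g t k i ^ 2).trans_le h1
          positivity⟩
        d_sign := hsens t
        sinr := fun _ _ => le_rfl
        gain := fun k i => (Real.sq_sqrt ((hXfeas t).sensGain_nonneg S k i)).le
        sens := fun _ _ => le_rfl
        mode := (hXfeas t).mode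
        power := (hXfeas t).power
        schur := fun k i => (posSemidef_schurBlock_iff _ k i).2 ((hXfeas t).psd k i) }
  have hval : ∀ᶠ t in atTop, S.auxObjective (S.sinrSurrogate (x t) (segmentPath (x t) z ε))
      (S.sensSurrogate (x t) (g t) (segmentPath (x t) z ε)
        fun k i => √(S.sensGain (segmentPath (x t) z ε) k i)) ≤ S.objective (x (t + 1)) := by
    filter_upwards [hsub] with t ht
    have := h.auxObjective_le_objective_succ t ht
    dsimp only at this
    exact this
  have hobj : Tendsto (fun t => S.objective (x (t + 1))) atTop (𝓝 (S.objective xlim)) :=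
    (S.differentiableAt_objective hfeas fun hw k =>
      h.sensInfo_limit_pos hlim hw k).continuousAt.tendsto.comp
        ((tendsto_add_atTop_iff_nat 1).2 hlim)
  refine le_of_tendsto_of_tendsto (S.tendsto_auxObjective hsinr
    (fun k i => (add_pos_of_pos_of_nonneg one_pos (hr' k i)).ne') (fun hw k i => ?_)
    fun hw k => (hd hw k).ne') hobj hval
  refine tendsto_sensSurrogate hlim hX k i ?_
    (zero_lt_one.trans_le (hfeas.one_le_siNoise S k i)).ne'
  -- The index is shifted because the initial g 0 need not attain its bound.
  rw [← tendsto_add_atTop_iff_nat 1]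
  simp only [h.eq_sqrt_sensGain hw]
  exact (((S.differentiable_sensGain k i).continuous.tendsto xlim).comp
    ((tendsto_add_atTop_iff_nat 1).2 hlim)).sqrt

theorem eventually_surrogateObjective_le_objective (h : S.IsSCARun m x g)
    (hlim : Tendsto x atTop (𝓝 xlim)) {z : Design M} (hz : IsFeasible m z)
    (hsig : ∀ k i, S.signal xlim k i = 0 → S.signal z k i = 0) :
    ∀ᶠ ε in 𝓝[>] 0, S.surrogateObjective xlim (segmentPath xlim z ε) ≤ S.objective xlim := by
  have hfeas := IsFeasible.of_tendsto h.feasible hlim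
  have hpath := (tendsto_segmentPath xlim z).mono_left (nhdsWithin_le_nhds (s := Set.Ioi 0))
  have hid : Tendsto (fun ε : ℝ => ε) (𝓝[>] 0) (𝓝 0) := nhdsWithin_le_nhds
  have hsmall : ∀ c : ℝ, ∀ᶠ ε in 𝓝[>] (0 : ℝ), ε * c < 1 - ε := fun c =>
    (hid.mul_const c).eventually_lt (hid.const_sub 1) (by simp)
  have hr : ∀ᶠ ε in 𝓝[>] 0, ∀ k i, S.signal xlim k i ≠ 0 →
      0 < S.sinrSurrogate xlim (segmentPath xlim z ε) k i := by
    refine eventually_all.2 fun k => eventually_all.2 fun i => eventually_all.2 fun h0 => ?_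
    refine (((differentiable_sinrSurrogate xlim k i).continuous.tendsto xlim).comp
      hpath).eventually_const_lt ?_
    have hI := zero_lt_one.trans_le (hfeas.one_le_interf S k i)
    rw [S.sinrSurrogate_self hI]
    have := S.rhoC_pos
    exact div_pos (mul_pos this (by positivity)) hI
  have hd : ∀ᶠ ε in 𝓝[>] 0, S.weight < 1 → ∀ k, 0 < ∑ i, S.sensSurrogate xlim
      (fun k i => √(S.sensGain xlim k i)) (segmentPath xlim z ε)
      (fun k i => √(S.sensGain (segmentPath xlim z ε) k i)) k i := by
    refine eventually_all.2 fun hw => eventually_all.2 fun k => ?_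
    have h1 := tendsto_finsetSum Finset.univ fun i _ => ((continuous_sensSurrogate (S := S) xlim
      (fun k i => √(S.sensGain xlim k i)) k i).tendsto xlim).comp hpath
    rw [sum_sensSurrogate_sqrt_self hfeas] at h1
    exact h1.eventually_const_lt (h.sensInfo_limit_pos hlim hw k)
  have hB : ∀ᶠ ε in 𝓝[>] (0 : ℝ), ∀ k i, ε * S.siNoise z k i < 1 - ε :=
    eventually_all.2 fun k => eventually_all.2 fun i => hsmall _
  have hI : ∀ᶠ ε in 𝓝[>] (0 : ℝ), ∀ k i, ε * S.interf z k i < 1 - ε :=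
    eventually_all.2 fun k => eventually_all.2 fun i => hsmall _
  filter_upwards [hr, hd, hB, hI, self_mem_nhdsWithin, hid.eventually_lt_const one_pos]
    with ε hr hd hB hI hε₀ hε₁
  exact h.surrogateObjective_le_objective hlim hz hsig hε₀ hε₁ hB hI hr hd

/-- Objective minus surrogate has a local minimum at ε = 0 along the path, so both have the same
derivative there; the one-sided slopes of the surrogate are nonpositive. -/
theorem fderiv_objective_nonpos_of_signal (h : S.IsSCARun m x g)
    (hlim : Tendsto x atTop (𝓝 xlim)) {z : Design M} (hz : IsFeasible m z)
    (hsig : ∀ k i, S.signal xlim k i = 0 → S.signal z k i = 0) :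
    fderiv ℝ S.objective xlim (z - xlim) ≤ 0 := by
  have hfeas := IsFeasible.of_tendsto h.feasible hlim
  have hinfo : S.weight < 1 → ∀ k, 0 < S.sensInfo xlim k := fun hw k =>
    h.sensInfo_limit_pos hlim hw k
  have hpath := hasDerivAt_segmentPath xlim z
  have hobj : HasDerivAt (fun ε => S.objective (segmentPath xlim z ε))
      (fderiv ℝ S.objective xlim (z - xlim)) 0 :=
    HasFDerivAt.comp_hasDerivAt_of_eq 0
      (S.differentiableAt_objective hfeas hinfo).hasFDerivAt hpath (segmentPath_zero _ _).symm
  have hsur : HasDerivAt (fun ε => S.surrogateObjective xlim (segmentPath xlim z ε))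
      (fderiv ℝ (S.surrogateObjective xlim) xlim (z - xlim)) 0 :=
    HasFDerivAt.comp_hasDerivAt_of_eq 0
      (differentiableAt_surrogateObjective hfeas hinfo).hasFDerivAt hpath
        (segmentPath_zero _ _).symm
  have hmin : IsLocalMin (fun ε => S.objective (segmentPath xlim z ε) -
      S.surrogateObjective xlim (segmentPath xlim z ε)) 0 := by
    filter_upwards [eventually_surrogateObjective_le hfeas hz hinfo] with ε hε
    rw [segmentPath_zero, surrogateObjective_self hfeas, sub_self]
    exact sub_nonneg.2 hε
  have heq := hmin.hasDerivAt_eq_zero (hobj.sub hsur)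
  rw [sub_eq_zero.1 heq]
  refine le_of_tendsto hsur.tendsto_slope_zero_right ?_
  filter_upwards [h.eventually_surrogateObjective_le_objective hlim hz hsig,
    self_mem_nhdsWithin] with ε hε hε₀
  rw [zero_add, segmentPath_zero, surrogateObjective_self hfeas, smul_eq_mul]
  exact mul_nonpos_of_nonneg_of_nonpos (inv_nonneg.2 (Set.mem_Ioi.1 hε₀).le) (sub_nonpos.2 hε)

end IsSCARun

end ISACSystem

/-! ### Symmetries along lines as identities for the derivative -/

section LineDerivative

variable {E : Type*} [NormedAddCommGroup E] [NormedSpace ℝ E]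

theorem hasDerivAt_add_smul (x v : E) : HasDerivAt (fun t : ℝ => x + t • v) v 0 := by
  simpa using ((hasDerivAt_id (0 : ℝ)).smul_const v).const_add x

theorem HasFDerivAt.hasDerivAt_add_smul {f : E → ℝ} {ℓ : E →L[ℝ] ℝ} {x : E}
    (hf : HasFDerivAt f ℓ x) (v : E) : HasDerivAt (fun t : ℝ => f (x + t • v)) (ℓ v) 0 :=
  hf.comp_hasDerivAt_of_eq 0 (_root_.hasDerivAt_add_smul x v) (by simp)

theorem HasFDerivAt.apply_eq_of_line_eq {f : E → ℝ} {ℓ : E →L[ℝ] ℝ} {x v w : E}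
    (hf : HasFDerivAt f ℓ x) (h : ∀ t : ℝ, f (x + t • v) = f (x + t • w)) : ℓ v = ℓ w := by
  have h1 := hf.hasDerivAt_add_smul v
  rw [funext h] at h1
  exact h1.unique (hf.hasDerivAt_add_smul w)

theorem HasFDerivAt.apply_eq_zero_of_line_even {f : E → ℝ} {ℓ : E →L[ℝ] ℝ} {x v : E}
    (hf : HasFDerivAt f ℓ x) (h : ∀ t : ℝ, f (x + t • v) = f (x + t • -v)) : ℓ v = 0 := by
  have := hf.apply_eq_of_line_eq h
  rw [map_neg] at this
  linarith

end LineDerivative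

/-! ### Removal of the restriction on vanishing signals -/

section Symmetry

variable {M : ℕ} (S : ISACSystem M) {m : DuplexMode}

namespace ISACSystem

theorem objective_congr {x y : Design M} (hquad : ∀ k i v, hermQuad v (x.2 k i) =
      hermQuad v (y.2 k i)) (hsig : ∀ k i, ‖S.signal x k i‖ = ‖S.signal y k i‖) :
    S.objective x = S.objective y := by
  simp only [objective, rate, crb, sensInfo, sinr, interf, sensGain, siNoise, Phi, hquad, hsig]

theorem signal_add_smul (x v : Design M) (t : ℝ) (k i : Fin 2) :
    S.signal (x + t • v) k i = S.signal x k i + t * S.signal v k i := by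
  have := S.signal_combo x v k i 1 t
  simpa using this

/-- Beams enter the objective only through the norm of the received signal, which is even in t if
the signal is 0 at x and constant if v contributes none. -/
theorem objective_line_even {x v : Design M} (hv : v.2 = 0)
    (hsig : ∀ k i, S.signal x k i = 0 ∨ S.signal v k i = 0) (t : ℝ) :
    S.objective (x + t • v) = S.objective (x + t • -v) := by
  refine S.objective_congr (fun k i w => ?_) fun k i => ?_
  · simp [hv]
  · rw [smul_neg, ← neg_smul, signal_add_smul, signal_add_smul]
    rcases hsig k i with h | h <;> simp [h]

/-- The beams of z whose signal vanishes at the limit are set to 0. Feasibility survives because Q ⪰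
0, and evenness makes the derivative along the discarded part zero. -/
theorem IsSCARun.fderiv_objective_nonpos {x : ℕ → Design M} {g : ℕ → Fin 2 → Fin 2 → ℝ}
    {xlim : Design M} (h : S.IsSCARun m x g) (hlim : Tendsto x atTop (𝓝 xlim)) {z : Design M}
    (hz : IsFeasible m z) : fderiv ℝ S.objective xlim (z - xlim) ≤ 0 := by
  classical
  have hfeas := IsFeasible.of_tendsto h.feasible hlim
  set z' : Design M := (fun k i => if S.signal xlim k.rev i = 0 then 0 else z.1 k i, z.2) with hz'
  have hz'feas : IsFeasible m z' := by
    refine IsFeasible.of_hermQuad hz.mode hz.power hz.isHermitian fun k i v => ?_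
    have h1 := hz.hermQuad_sensCov_nonneg k i v
    by_cases h0 : S.signal xlim k.rev i = 0
    · have h2 : z'.1 k i = 0 := if_pos h0
      rw [hermQuad_sensCov, h2]
      simpa using hz.hermQuad_nonneg k i v
    · have h2 : z'.1 k i = z.1 k i := if_neg h0
      rw [hermQuad_sensCov] at h1 ⊢
      rw [h2]
      exact h1
  have h1 := h.fderiv_objective_nonpos_of_signal hlim hz'feas fun k i h0 => by
    unfold signal at h0
    simp [signal, hz', h0]
  have h2 : fderiv ℝ S.objective xlim (z - z') = 0 := by
    refine (S.differentiableAt_objective hfeas fun hw k =>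
      h.sensInfo_limit_pos hlim hw k).hasFDerivAt.apply_eq_zero_of_line_even
        (S.objective_line_even (sub_self _) fun k i => ?_)
    by_cases h0 : S.signal xlim k i = 0
    · exact Or.inl h0
    · right
      unfold signal at h0
      simp [signal, hz', h0]
  have h3 : z - xlim = (z - z') + (z' - xlim) := by abel
  rw [h3, map_add, h2, zero_add]
  exact h1

end ISACSystem

/-- With Q = 0, testing -wwᴴ against w itself gives -‖w‖⁴ ≥ 0. -/
theorem IsFeasible.beam_eq_zero_of_not_transmits {x : Design M} (h : IsFeasible m x) {k i : Fin 2}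
    (hki : ¬ Transmits m k i) : x.1 k i = 0 := by
  have h1 := h.hermQuad_sensCov_nonneg k i (x.1 k i)
  rw [hermQuad_sensCov, h.mode.eq_zero_of_not_transmits hki, hermQuad_zero] at h1
  have h2 : ‖star (x.1 k i) ⬝ᵥ x.1 k i‖ = 0 := by
    nlinarith [sq_nonneg ‖star (x.1 k i) ⬝ᵥ x.1 k i‖]
  exact dotProduct_star_self_eq_zero.1 (norm_eq_zero.1 h2)

end Symmetry

/-! ### The constraint cone and its dual -/

section Duality

variable {M : ℕ} (m : DuplexMode)

/-- The real subspace of designs with Hermitian covariances which satisfy the mode constraint and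
have no beamformer in idle half-intervals. -/
def modeSubmodule (M : ℕ) : Submodule ℝ (Design M) where
  carrier := {x | ModeConstraint m x ∧ (∀ k i, (x.2 k i).IsHermitian) ∧
    ∀ k i, ¬ Transmits m k i → x.1 k i = 0}
  zero_mem' := ⟨fun k => by cases m <;> simp [modeResidual], fun _ _ => Matrix.isHermitian_zero,
    fun _ _ _ => rfl⟩
  add_mem' := by
    rintro x y ⟨h1, h2, h3⟩ ⟨h1', h2', h3'⟩
    refine ⟨fun k => ?_, fun k i => (h2 k i).add (h2' k i), fun k i hki => ?_⟩
    · have := modeResidual_combo m x y k 1 1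
      simpa [h1 k, h1' k] using this
    · simp [h3 k i hki, h3' k i hki]
  smul_mem' := by
    rintro c x ⟨h1, h2, h3⟩
    refine ⟨fun k => ?_, fun k i => (h2 k i).smul (IsSelfAdjoint.all c), fun k i hki => ?_⟩
    · have := modeResidual_combo m x x k c 0
      simpa [h1 k] using this
    · simp [h3 k i hki]

variable {m}

theorem IsFeasible.mem_modeSubmodule {x : Design M} (h : IsFeasible m x) :
    x ∈ modeSubmodule m M :=
  ⟨h.mode, h.isHermitian, fun _ _ hki => h.beam_eq_zero_of_not_transmits hki⟩

/-- Product of the nonnegative orthant and the cones of matrices with positive semidefinite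
Hermitian part. -/
def constraintCone (M : ℕ) :
    PointedCone ℝ ((Fin 2 → ℝ) × (Fin 2 → Fin 2 → Matrix (Fin M) (Fin M) ℂ)) where
  carrier := {p | (∀ k, 0 ≤ p.1 k) ∧ ∀ k i v, 0 ≤ hermQuad v (p.2 k i)}
  zero_mem' := ⟨fun _ => le_rfl, fun k i v => by simp [hermQuad_zero]⟩
  add_mem' := fun ha hb => ⟨fun k => add_nonneg (ha.1 k) (hb.1 k), fun k i v => by
    simpa [hermQuad_add] using add_nonneg (ha.2 k i v) (hb.2 k i v)⟩
  smul_mem' := fun c p hp => ⟨fun k => mul_nonneg c.2 (hp.1 k), fun k i v => by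
    have h : (c • p).2 k i = (c : ℝ) • p.2 k i := rfl
    rw [h, hermQuad_smul]
    exact mul_nonneg c.2 (hp.2 k i v)⟩

/-- The cone constrains only Hermitian parts, so it has interior points in the space of all complex
matrices, as separation requires. -/
theorem mem_interior_constraintCone
    {p : (Fin 2 → ℝ) × (Fin 2 → Fin 2 → Matrix (Fin M) (Fin M) ℂ)} (h1 : ∀ k, 0 < p.1 k)
    (h2 : ∀ k i, ∃ c : ℝ, 0 < c ∧ p.2 k i = c • 1) :
    p ∈ interior (constraintCone M : Set _) := by
  rw [mem_interior_iff_mem_nhds]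
  have ha : ∀ᶠ q in 𝓝 p, ∀ k, 0 ≤ q.1 k := eventually_all.2 fun k =>
    (((by fun_prop : Continuous fun q : (Fin 2 → ℝ) × (Fin 2 → Fin 2 →
      Matrix (Fin M) (Fin M) ℂ) => q.1 k).tendsto p).eventually_const_lt (h1 k)).mono
        fun _ h => h.le
  have hb : ∀ᶠ q in 𝓝 p, ∀ k i v, 0 ≤ hermQuad v (q.2 k i) :=
    eventually_all.2 fun k => eventually_all.2 fun i => by
      obtain ⟨c, hc, hp⟩ := h2 k i
      have h3 := (by fun_prop : Continuous fun q : (Fin 2 → ℝ) × (Fin 2 → Fin 2 →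
        Matrix (Fin M) (Fin M) ℂ) => q.2 k i).tendsto p
      rw [hp] at h3
      exact h3.eventually (eventually_hermQuad_nonneg hc)
  filter_upwards [ha, hb] with q hqa hqb using ⟨hqa, hqb⟩

/-- Nonnegative functionals on the constraint cone are given by nonnegative numbers and positive
semidefinite matrices. -/
theorem exists_multipliers_of_nonneg
    (μ : ((Fin 2 → ℝ) × (Fin 2 → Fin 2 → Matrix (Fin M) (Fin M) ℂ)) →L[ℝ] ℝ)
    (hμ : ∀ p ∈ constraintCone M, 0 ≤ μ p) :
    ∃ (lam : Fin 2 → ℝ) (U : Fin 2 → Fin 2 → Matrix (Fin M) (Fin M) ℂ),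
      (∀ k, 0 ≤ lam k) ∧ (∀ k i, (U k i).PosSemidef) ∧
      (∀ k i Y, (∀ v, 0 ≤ hermQuad v Y) → 0 ≤ (U k i * Y).trace.re) ∧
      ∀ p, μ p = ∑ k, lam k * p.1 k + ∑ k, ∑ i, (U k i * p.2 k i).trace.re := by
  classical
  let ν : Fin 2 → Fin 2 → Matrix (Fin M) (Fin M) ℂ →ₗ[ℝ] ℝ := fun k i =>
    μ.toLinearMap ∘ₗ LinearMap.inr ℝ _ _ ∘ₗ
      LinearMap.single ℝ (fun _ : Fin 2 => Fin 2 → Matrix (Fin M) (Fin M) ℂ) k ∘ₗ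
      LinearMap.single ℝ (fun _ : Fin 2 => Matrix (Fin M) (Fin M) ℂ) i
  have hνapp : ∀ k i Y, ν k i Y = μ (0, Pi.single k (Pi.single i Y)) := fun _ _ _ => rfl
  have hνnonneg : ∀ k i Y, (∀ v, 0 ≤ hermQuad v Y) → 0 ≤ ν k i Y := fun k i Y hY => by
    rw [hνapp]
    refine hμ _ ⟨fun _ => le_rfl, fun k' i' v => ?_⟩
    by_cases hk : k' = k
    · subst hk
      by_cases hi : i' = i
      · subst hi
        simpa using hY v
      · simp [hi, hermQuad_zero]
    · simp [hk, hermQuad_zero]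
  -- The form of Y - Yᴴ is zero, so both signs of this matrix lie in the cone and the functional
  -- must vanish on it.
  have hνconj : ∀ k i Y, ν k i Yᴴ = ν k i Y := fun k i Y => by
    have h1 := hνnonneg k i (Y - Yᴴ) fun v => by simp [hermQuad_sub, hermQuad_conjTranspose]
    have h2 := hνnonneg k i (Yᴴ - Y) fun v => by simp [hermQuad_sub, hermQuad_conjTranspose]
    rw [map_sub] at h1 h2
    linarith
  choose U hUherm hU using fun k i => exists_isHermitian_re_trace_mul (ν k i) (hνconj k i)
  refine ⟨fun k => μ (Pi.single k 1, 0), U, fun k => hμ _ ⟨fun k' => ?_, fun k' i v => ?_⟩,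
    fun k i => ?_, fun k i Y hY => ?_, fun p => ?_⟩
  · by_cases hk : k' = k
    · subst hk; simp
    · simp [hk]
  · simp [hermQuad_zero]
  · refine posSemidef_iff_hermQuad.2 ⟨hUherm k i, fun v => ?_⟩
    rw [← re_trace_mul_vecMulVec, ← hU]
    refine hνnonneg k i _ fun w => ?_
    rw [hermQuad_vecMulVec]
    positivity
  · rw [← hU]
    exact hνnonneg k i Y hY
  · simp only [← hU, hνapp]
    have h1 : p = (∑ k, p.1 k • ((Pi.single k 1, 0) :
        (Fin 2 → ℝ) × (Fin 2 → Fin 2 → Matrix (Fin M) (Fin M) ℂ))) +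
        ∑ k, ∑ i, (0, Pi.single k (Pi.single i (p.2 k i))) := by
      refine Prod.ext ?_ ?_
      · funext k
        fin_cases k <;> simp [Fin.sum_univ_two]
      · funext k i
        fin_cases k <;> fin_cases i <;> simp [Fin.sum_univ_two]
    conv_lhs => rw [h1]
    simp only [map_add, map_sum, map_smul, smul_eq_mul]
    congr 1
    exact Finset.sum_congr rfl fun k _ => mul_comm _ _

end Duality

/-! ### Multipliers and the KKT conditions -/

section KKT

variable {M : ℕ} {S : ISACSystem M} {m : DuplexMode}

/-- A strictly feasible design, up to the idle half-intervals. -/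
theorem exists_slater_design (m : DuplexMode) (M : ℕ) :
    ∃ x₁ ∈ modeSubmodule m M, (∀ k, powerExcess x₁ k < 0) ∧
      ∀ k i, Transmits m k i → ∃ c : ℝ, 0 < c ∧ sensCov x₁ k i = c • 1 := by
  classical
  -- The total trace per transceiver is at most 2cM = M/(M + 1), below the budget 2; c stays
  -- positive for M = 0.
  set c : ℝ := 1 / (2 * (M + 1)) with hc
  have hcpos : 0 < c := by positivity
  refine ⟨(0, fun k i => if Transmits m k i then c • 1 else 0), ⟨fun k => ?_, fun k i => ?_,
    fun _ _ _ => rfl⟩, fun k => ?_, fun k i hki => ⟨c, hcpos, ?_⟩⟩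
  · cases m
    · simp [modeResidual, Transmits]
    · fin_cases k <;> simp [modeResidual, Transmits, Fin.rev]
  · by_cases hki : Transmits m k i
    · simp only [hki, if_true]
      exact Matrix.isHermitian_one.smul (IsSelfAdjoint.all c)
    · simp only [hki, if_false]
      exact Matrix.isHermitian_zero
  · have hle : ∀ i, (if Transmits m k i then c • (1 : Matrix (Fin M) (Fin M) ℂ)
        else 0).trace.re ≤ c * M := fun i => by
      split_ifs
      · simp [Matrix.trace_smul]
      · simp only [Matrix.trace_zero, Complex.zero_re]
        positivity
    have h2 : 2 * (c * M) < 2 := by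
      rw [hc, one_div_mul_eq_div, ← mul_div_assoc, div_lt_iff₀ (by positivity)]
      have : (0 : ℝ) ≤ M := Nat.cast_nonneg M
      linarith
    simp only [powerExcess, Fin.sum_univ_two, Complex.add_re]
    linarith [hle 0, hle 1]
  · simp [sensCov, hki]

open Classical in
/-- The constraints of the problem on `modeSubmodule`, with trivial constraints in idle
half-intervals. -/
def constraintMap (m : DuplexMode) (x : Design M) :
    (Fin 2 → ℝ) × (Fin 2 → Fin 2 → Matrix (Fin M) (Fin M) ℂ) :=
  (fun k => -powerExcess x k, fun k i => if Transmits m k i then sensCov x k i else 1)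

theorem constraintMap_snd_of_transmits {x : Design M} {k i : Fin 2} (hki : Transmits m k i) :
    (constraintMap m x).2 k i = sensCov x k i := if_pos hki

theorem constraintMap_snd_of_not_transmits {x : Design M} {k i : Fin 2}
    (hki : ¬ Transmits m k i) : (constraintMap m x).2 k i = 1 := if_neg hki

theorem constraintMap_concave (x y : Design M) {a b : ℝ} (ha : 0 ≤ a) (hb : 0 ≤ b)
    (hab : a + b = 1) :
    constraintMap m (a • x + b • y) - (a • constraintMap m x + b • constraintMap m y) ∈
      constraintCone M := by
  refine ⟨fun k => ?_, fun k i v => ?_⟩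
  · have h := powerExcess_combo x y k hab
    simp only [constraintMap, Prod.fst_sub, Prod.fst_add, Prod.smul_fst, Pi.sub_apply,
      Pi.add_apply, Pi.smul_apply, smul_eq_mul, h]
    linarith
  · have h : (constraintMap m (a • x + b • y) -
        (a • constraintMap m x + b • constraintMap m y)).2 k i =
        (constraintMap m (a • x + b • y)).2 k i -
          (a • (constraintMap m x).2 k i + b • (constraintMap m y).2 k i) := rfl
    rw [h, hermQuad_sub, hermQuad_add, hermQuad_smul, hermQuad_smul]
    by_cases hki : Transmits m k i
    · simp only [constraintMap_snd_of_transmits hki]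
      linarith [le_hermQuad_sensCov_combo x y k i v ha hb hab]
    · simp only [constraintMap_snd_of_not_transmits hki]
      rw [← add_mul, hab, one_mul, sub_self]

theorem IsFeasible.constraintMap_mem {x : Design M} (h : IsFeasible m x) :
    constraintMap m x ∈ constraintCone M := by
  refine ⟨fun k => neg_nonneg.2 (h.power k), fun k i v => ?_⟩
  by_cases hki : Transmits m k i
  · rw [constraintMap_snd_of_transmits hki]
    exact h.hermQuad_sensCov_nonneg k i v
  · rw [constraintMap_snd_of_not_transmits hki, hermQuad_one]
    positivity

theorem IsFeasible.of_constraintMap_mem {x : Design M} (hx : x ∈ modeSubmodule m M)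
    (h : constraintMap m x ∈ constraintCone M) : IsFeasible m x := by
  refine IsFeasible.of_hermQuad hx.1 (fun k => neg_nonneg.1 (h.1 k)) hx.2.1 fun k i v => ?_
  by_cases hki : Transmits m k i
  · rw [← constraintMap_snd_of_transmits hki]
    exact h.2 k i v
  · rw [hermQuad_sensCov, hx.2.2 k i hki, hx.1.eq_zero_of_not_transmits hki, hermQuad_zero]
    simp

/-- Multipliers for a linear objective maximal at `x₀` over the feasible set. -/
theorem exists_multipliers_of_linear_max (L : Design M →ₗ[ℝ] ℝ) {x₀ : Design M}
    (hx₀ : IsFeasible m x₀) (hmax : ∀ z, IsFeasible m z → L z ≤ L x₀) :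
    ∃ (lam : Fin 2 → ℝ) (U : Fin 2 → Fin 2 → Matrix (Fin M) (Fin M) ℂ),
      (∀ k, 0 ≤ lam k) ∧ (∀ k i, (U k i).PosSemidef) ∧
      (∀ k i, ¬ Transmits m k i → U k i = 0) ∧
      (∀ k, lam k * powerExcess x₀ k = 0) ∧ (∀ k i, (U k i * sensCov x₀ k i).trace.re = 0) ∧
      ∀ x ∈ modeSubmodule m M, L x - L x₀ ≤ ∑ k, lam k * powerExcess x k -
        ∑ k, ∑ i, (U k i * sensCov x k i).trace.re := by
  classical
  obtain ⟨x₁, hx₁, hpow, hcov⟩ := exists_slater_design m M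
  obtain ⟨μ, hμ, hle⟩ := exists_nonneg_multiplier (C := (modeSubmodule m M : Set (Design M)))
    (modeSubmodule m M).convex (constraintCone M) L (constraintMap m)
    (fun x _ y _ a b ha hb hab => constraintMap_concave x y ha hb hab) hx₁
    (mem_interior_constraintCone (fun k => neg_pos.2 (hpow k)) fun k i => by
      by_cases hki : Transmits m k i
      · rw [constraintMap_snd_of_transmits hki]
        exact hcov k i hki
      · exact ⟨1, one_pos, by rw [constraintMap_snd_of_not_transmits hki, one_smul]⟩)
    hx₀.mem_modeSubmodule hx₀.constraintMap_mem
    fun x hx hGx => hmax x (IsFeasible.of_constraintMap_mem hx hGx)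
  obtain ⟨lam, U, hlam, hU, hUpos, hrep⟩ := exists_multipliers_of_nonneg μ hμ
  have h₀ := hle x₀ hx₀.mem_modeSubmodule
  rw [sub_self, zero_add, hrep] at h₀
  have hmem := hx₀.constraintMap_mem
  -- At x₀ the pairing with the multiplier is nonpositive while each of its terms is nonnegative.
  -- All terms vanish, which is complementary slackness.
  have hA : ∀ k, 0 ≤ lam k * (constraintMap m x₀).1 k := fun k => mul_nonneg (hlam k) (hmem.1 k)
  have hB : ∀ k i, 0 ≤ (U k i * (constraintMap m x₀).2 k i).trace.re := fun k i =>
    hUpos k i _ (hmem.2 k i)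
  have hAsum := Finset.sum_nonneg fun k (_ : k ∈ Finset.univ) => hA k
  have hBsum := Finset.sum_nonneg fun k (_ : k ∈ Finset.univ) =>
    Finset.sum_nonneg fun i (_ : i ∈ Finset.univ) => hB k i
  have hA0 : ∀ k, lam k * (constraintMap m x₀).1 k = 0 := fun k =>
    (Finset.sum_eq_zero_iff_of_nonneg fun k _ => hA k).1 (by linarith) k (Finset.mem_univ k)
  have hB0 : ∀ k i, (U k i * (constraintMap m x₀).2 k i).trace.re = 0 := fun k i =>
    (Finset.sum_eq_zero_iff_of_nonneg fun i _ => hB k i).1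
      ((Finset.sum_eq_zero_iff_of_nonneg fun k _ => Finset.sum_nonneg fun i _ => hB k i).1
        (by linarith) k (Finset.mem_univ k)) i (Finset.mem_univ i)
  refine ⟨lam, fun k i => if Transmits m k i then U k i else 0, hlam, fun k i => ?_,
    fun k i hki => if_neg hki, fun k => ?_, fun k i => ?_, fun x hx => ?_⟩
  · dsimp only
    split_ifs
    · exact hU k i
    · exact Matrix.PosSemidef.zero
  · have := hA0 k
    simp only [constraintMap] at this
    linarith
  · by_cases hki : Transmits m k i
    · simp only [hki, if_true]
      rw [← constraintMap_snd_of_transmits hki]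
      exact hB0 k i
    · simp [hki]
  · have h1 := hle x hx
    rw [hrep] at h1
    have h2 : ∑ k, lam k * (constraintMap m x).1 k = -∑ k, lam k * powerExcess x k := by
      simp [constraintMap]
    have h3 : ∑ k, ∑ i, (U k i * (constraintMap m x).2 k i).trace.re =
        ∑ k, ∑ i, ((if Transmits m k i then U k i else 0) * sensCov x k i).trace.re := by
      refine Finset.sum_congr rfl fun k _ => Finset.sum_congr rfl fun i _ => ?_
      by_cases hki : Transmits m k i
      · simp only [hki, if_true]
        rw [constraintMap_snd_of_transmits hki]
      -- The idle entry of the constraint map is constantly 1, so complementarity at x₀ removes this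
      -- term for every x and U may be replaced by 0.
      · have h4 := hB0 k i
        rw [constraintMap_snd_of_not_transmits hki] at h4 ⊢
        rw [h4]
        simp [hki]
    linarith

/-- The part of the Lagrangian coming from the power and covariance constraints. -/
def conicPenalty (lam : Fin 2 → ℝ) (U : Fin 2 → Fin 2 → Matrix (Fin M) (Fin M) ℂ)
    (x : Design M) : ℝ :=
  ∑ k, lam k * powerExcess x k - ∑ k, ∑ i, (U k i * sensCov x k i).trace.re

theorem differentiable_conicPenalty (lam : Fin 2 → ℝ)
    (U : Fin 2 → Fin 2 → Matrix (Fin M) (Fin M) ℂ) : Differentiable ℝ (conicPenalty lam U) := by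
  have hre : ∀ f : Design M → ℂ, Differentiable ℝ f → Differentiable ℝ fun x => (f x).re :=
    fun f hf => Complex.reCLM.differentiable.comp hf
  have h1 : ∀ k, Differentiable ℝ fun x : Design M => powerExcess x k := fun k => by
    refine (hre _ ?_).sub_const 2
    unfold Matrix.trace Matrix.diag
    fun_prop
  have h2 : ∀ k i, Differentiable ℝ fun x : Design M => (U k i * sensCov x k i).trace.re :=
    fun k i => by
      refine hre _ ?_
      have h3 : ∀ b, Differentiable ℝ fun x : Design M => star (x.1 k i b) := fun b =>
        (by fun_prop : Differentiable ℝ fun x : Design M => x.1 k i b).star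
      simp only [Matrix.trace, Matrix.diag, Matrix.mul_apply, sensCov, Matrix.sub_apply,
        Matrix.vecMulVec_apply, Pi.star_apply]
      fun_prop
  unfold conicPenalty
  fun_prop

/-- Conjugate transposition of the covariances. -/
def conjDesign (x : Design M) : Design M := (x.1, fun k i => (x.2 k i)ᴴ)

theorem conjDesign_add_smul (x v : Design M) (t : ℝ) :
    conjDesign (x + t • v) = conjDesign x + t • conjDesign v := by
  refine Prod.ext rfl ?_
  funext k i
  simp [conjDesign, Matrix.conjTranspose_add, Matrix.conjTranspose_smul]

theorem objective_conjDesign (x : Design M) : S.objective (conjDesign x) = S.objective x :=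
  S.objective_congr (fun _ _ _ => hermQuad_conjTranspose _ _) fun _ _ => rfl

theorem conicPenalty_conjDesign (lam : Fin 2 → ℝ)
    {U : Fin 2 → Fin 2 → Matrix (Fin M) (Fin M) ℂ} (hU : ∀ k i, (U k i).IsHermitian)
    (x : Design M) : conicPenalty lam U (conjDesign x) = conicPenalty lam U x := by
  have h1 : ∀ k, powerExcess (conjDesign x) k = powerExcess x k := fun k => by
    simp [powerExcess, conjDesign, Matrix.trace_conjTranspose]
  have h2 : ∀ k i, (U k i * sensCov (conjDesign x) k i).trace.re =
      (U k i * sensCov x k i).trace.re := fun k i => by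
    have h3 : sensCov (conjDesign x) k i = (sensCov x k i)ᴴ := by
      rw [sensCov, sensCov, Matrix.conjTranspose_sub, Matrix.conjTranspose_vecMulVec, star_star]
      rfl
    have h4 : U k i * (sensCov x k i)ᴴ = (sensCov x k i * U k i)ᴴ := by
      rw [Matrix.conjTranspose_mul, (hU k i).eq]
    rw [h3, h4, Matrix.trace_conjTranspose, Matrix.trace_mul_comm]
    simp
  simp only [conicPenalty, h1, h2]

/-- The half-interval in which the mode constraint determines `Q` for transceiver `k`. -/
def modePivot (m : DuplexMode) (k : Fin 2) : Fin 2 :=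
  match m with
  | .full => 0
  | .half => k.rev

/-- Embedding of a covariance at transceiver `k` in the pivot half-interval. -/
def pivotEmbed (m : DuplexMode) (k : Fin 2) : Matrix (Fin M) (Fin M) ℂ →ₗ[ℝ] Design M :=
  LinearMap.inr ℝ _ _ ∘ₗ
    LinearMap.single ℝ (fun _ : Fin 2 => Fin 2 → Matrix (Fin M) (Fin M) ℂ) k ∘ₗ
    LinearMap.single ℝ (fun _ : Fin 2 => Matrix (Fin M) (Fin M) ℂ) (modePivot m k)

theorem pivotEmbed_apply (k : Fin 2) (Y : Matrix (Fin M) (Fin M) ℂ) :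
    pivotEmbed m k Y = (0, Pi.single k (Pi.single (modePivot m k) Y)) := rfl

theorem conjDesign_pivotEmbed (k : Fin 2) (Y : Matrix (Fin M) (Fin M) ℂ) :
    conjDesign (pivotEmbed m k Y) = pivotEmbed m k Yᴴ := by
  refine Prod.ext rfl ?_
  funext k' i'
  by_cases hk : k' = k
  · subst hk
    by_cases hi : i' = modePivot m k'
    · subst hi
      simp [conjDesign, pivotEmbed_apply]
    · simp [conjDesign, pivotEmbed_apply, hi]
  · simp [conjDesign, pivotEmbed_apply, hk]

/-- The mode residual as a linear map. -/
def modeResidualLM (m : DuplexMode) (k : Fin 2) : Design M →ₗ[ℝ] Matrix (Fin M) (Fin M) ℂ where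
  toFun x := modeResidual m x k
  map_add' x y := by simpa using modeResidual_combo m x y k 1 1
  map_smul' c x := by simpa using modeResidual_combo m x 0 k c 0

theorem modeResidualLM_apply (k : Fin 2) (x : Design M) :
    modeResidualLM m k x = modeResidual m x k := rfl

/-- The pivot embeddings are right inverses of the residuals, so subtracting them projects any
design onto the mode constraint. -/
theorem modeResidual_pivotEmbed (k k' : Fin 2) (Y : Matrix (Fin M) (Fin M) ℂ) :
    modeResidual m (pivotEmbed m k' Y) k = if k = k' then Y else 0 := by
  rw [pivotEmbed_apply]
  by_cases hk : k = k'
  · subst hk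
    cases m <;> simp [modeResidual, modePivot]
  · cases m <;> simp [modeResidual, hk]

theorem modeConstraint_sub_pivotEmbed (v : Design M) :
    ModeConstraint m (v - ∑ k, pivotEmbed m k (modeResidual m v k)) := fun k => by
  rw [← modeResidualLM_apply, map_sub, map_sum]
  simp only [modeResidualLM_apply, modeResidual_pivotEmbed]
  simp

/-- A functional vanishing on `modeSubmodule`, with the symmetries of the Lagrangian, factors
through the mode residuals. -/
theorem eq_sum_pivotEmbed (ℓ : Design M →L[ℝ] ℝ) (hmode : ∀ v ∈ modeSubmodule m M, ℓ v = 0)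
    (hconj : ∀ v, ℓ (conjDesign v) = ℓ v)
    (hidle : ∀ v : Design M, v.2 = 0 → (∀ k i, Transmits m k i → v.1 k i = 0) → ℓ v = 0)
    (v : Design M) : ℓ v = ∑ k, ℓ (pivotEmbed m k (modeResidual m v k)) := by
  classical
  set u := v - ∑ k, pivotEmbed m k (modeResidual m v k) with hu
  have humode : ModeConstraint m u := modeConstraint_sub_pivotEmbed v
  set n : Design M := (fun k i => if Transmits m k i then 0 else u.1 k i, 0) with hn
  set s : Design M := (fun k i => if Transmits m k i then u.1 k i else 0,
    fun k i => (1 / 2 : ℝ) • (u.2 k i + (u.2 k i)ᴴ)) with hs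
  -- Averaging with the conjugate leaves ℓ unchanged and makes the covariances Hermitian. What
  -- remains is an idle-beam part n, killed by `hidle`, and a part s in the mode subspace.
  have hsum : (1 / 2 : ℝ) • (u + conjDesign u) = n + s := by
    refine Prod.ext ?_ ?_
    · funext k i
      by_cases hki : Transmits m k i
      · simp only [conjDesign, hn, hs, Prod.smul_fst, Prod.fst_add, Pi.smul_apply, Pi.add_apply,
          hki, if_true, zero_add]
        rw [← two_smul ℝ, smul_smul]
        norm_num
      · simp only [conjDesign, hn, hs, Prod.smul_fst, Prod.fst_add, Pi.smul_apply, Pi.add_apply,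
          hki, if_false, add_zero]
        rw [← two_smul ℝ, smul_smul]
        norm_num
    · simp only [Prod.snd_add, Prod.smul_snd, hn, hs, zero_add]
      rfl
  have hsmem : s ∈ modeSubmodule m M := by
    refine ⟨fun k => ?_, fun k i => ?_, fun k i hki => if_neg hki⟩
    · have h := humode k
      cases m
      · have h' : u.2 k 0 = u.2 k 1 := sub_eq_zero.1 h
        simp [modeResidual, hs, h']
      · have h' : u.2 k k.rev = 0 := h
        simp [modeResidual, hs, h']
    · refine Matrix.IsHermitian.smul ?_ (IsSelfAdjoint.all _)
      exact Matrix.isHermitian_add_transpose_self _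
  have hℓu : ℓ u = 0 := by
    have h1 : ℓ ((1 / 2 : ℝ) • (u + conjDesign u)) = ℓ u := by
      rw [map_smul, map_add, hconj, smul_eq_mul]
      ring
    rw [← h1, hsum, map_add, hmode s hsmem, add_zero]
    exact hidle n rfl fun k i hki => if_pos hki
  rw [hu, map_sub, map_sum, sub_eq_zero] at hℓu
  exact hℓu

/-- First-order stationarity over the feasible set yields a KKT point. -/
theorem ISACSystem.isKKTPoint_of_stationary {x : Design M} (hx : IsFeasible m x)
    (hinfo : S.weight < 1 → ∀ k, 0 < S.sensInfo x k)
    (hstat : ∀ z, IsFeasible m z → fderiv ℝ S.objective x (z - x) ≤ 0) : S.IsKKTPoint m x := by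
  set L := fderiv ℝ S.objective x with hL
  have hobj : HasFDerivAt S.objective L x := (S.differentiableAt_objective hx hinfo).hasFDerivAt
  obtain ⟨lam, U, hlam, hU, hUidle, hcs, hcsU, hmax⟩ :=
    exists_multipliers_of_linear_max L.toLinearMap hx fun z hz => by
      have := hstat z hz
      rw [map_sub] at this
      exact sub_nonpos.1 this
  have hpen : HasFDerivAt (conicPenalty lam U) (fderiv ℝ (conicPenalty lam U) x) x :=
    (differentiable_conicPenalty lam U x).hasFDerivAt
  set H := fderiv ℝ (conicPenalty lam U) x with hH
  have hΛ : HasFDerivAt (fun y => -S.objective y + conicPenalty lam U y) (-L + H) x :=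
    hobj.neg.add hpen
  have hmode : ∀ v ∈ modeSubmodule m M, (-L + H) v = 0 := fun v hv => by
    have hx0 : conicPenalty lam U x = 0 := by
      simp [conicPenalty, hcs, hcsU]
    -- The multiplier inequality holds for t of either sign, since v ranges over a subspace, and it
    -- is an equality at t = 0.
    have hmin : IsLocalMin (fun t : ℝ => conicPenalty lam U (x + t • v) - t * L v) 0 := by
      refine Eventually.of_forall fun t => ?_
      have h1 := hmax (x + t • v) ((modeSubmodule m M).add_mem hx.mem_modeSubmodule
        ((modeSubmodule m M).smul_mem t hv))
      have h2 : L (x + t • v) - L x = t * L v := by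
        rw [map_add, map_smul, smul_eq_mul]; ring
      have h3 : L (x + t • v) - L x ≤ conicPenalty lam U (x + t • v) := h1
      simp only [zero_smul, add_zero, zero_mul, hx0, sub_zero]
      linarith
    have := hmin.hasDerivAt_eq_zero ((hpen.hasDerivAt_add_smul v).sub
      ((hasDerivAt_id (0 : ℝ)).mul_const (L v)))
    rw [one_mul, sub_eq_zero] at this
    exact neg_add_eq_zero.2 this.symm
  have hxconj : conjDesign x = x := Prod.ext rfl (funext fun k => funext fun i => hx.isHermitian k i)
  have hconj : ∀ v, (-L + H) (conjDesign v) = (-L + H) v := fun v => by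
    refine hΛ.apply_eq_of_line_eq fun t => ?_
    have : x + t • conjDesign v = conjDesign (x + t • v) := by
      rw [conjDesign_add_smul, hxconj]
    rw [this, objective_conjDesign, conicPenalty_conjDesign lam fun k i => (hU k i).isHermitian]
  have hidle : ∀ v : Design M, v.2 = 0 → (∀ k i, Transmits m k i → v.1 k i = 0) →
      (-L + H) v = 0 := fun v hv2 hv1 => by
    refine hΛ.apply_eq_zero_of_line_even fun t => ?_
    rw [S.objective_line_even hv2 fun k i => ?_]
    · congr 1
      have h1 : ∀ c : ℝ, conicPenalty lam U (x + c • v) = conicPenalty lam U x := fun c => by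
        have h2 : ∀ k, powerExcess (x + c • v) k = powerExcess x k := fun k => by
          simp [powerExcess, hv2]
        have h3 : ∀ k i, (U k i * sensCov (x + c • v) k i).trace.re =
            (U k i * sensCov x k i).trace.re := fun k i => by
          by_cases hki : Transmits m k i
          · simp [sensCov, hv2, hv1 k i hki]
          · simp [hUidle k i hki]
        simp only [conicPenalty, h2, h3]
      rw [smul_neg, ← neg_smul, h1, h1]
    · by_cases hki : Transmits m k.rev i
      · right
        simp [ISACSystem.signal, hv1 _ _ hki]
      · left
        simp [ISACSystem.signal, hx.beam_eq_zero_of_not_transmits hki]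
  have hsplit := eq_sum_pivotEmbed (-L + H) hmode hconj hidle
  -- V represents minus the remaining gradient on the pivot directions, so the linear mode term
  -- cancels that gradient everywhere. Conjugation invariance makes V Hermitian.
  choose V hVherm hV using fun k => exists_isHermitian_re_trace_mul
    (-((-L + H).toLinearMap ∘ₗ pivotEmbed m k)) fun Y => by
      have := hconj (pivotEmbed m k Y)
      rw [conjDesign_pivotEmbed] at this
      exact congrArg Neg.neg this
  refine ⟨hx, hinfo, lam, U, V, hlam, hU, hVherm, ?_, hcs, fun k i => ?_⟩
  · have hfun : S.lagrangian m lam U V =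
        fun y => (-S.objective y + conicPenalty lam U y) + -(-L + H) y := by
      funext y
      have h1 : ∑ k, (V k * modeResidual m y k).trace.re = -(-L + H) y := by
        rw [hsplit y, ← Finset.sum_neg_distrib]
        exact Finset.sum_congr rfl fun k _ => (hV k _).symm
      rw [ISACSystem.lagrangian, h1, conicPenalty]
      ring
    rw [hfun]
    have := hΛ.add (-(-L + H)).hasFDerivAt
    exact this.congr_fderiv (add_neg_cancel (-L + H))
  -- Only the real part of the trace is known to vanish; the trace of a product of two Hermitian
  -- matrices is real.
  · refine Complex.ext (hcsU k i) ?_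
    have h1 : star (U k i * sensCov x k i).trace = (U k i * sensCov x k i).trace := by
      rw [← Matrix.trace_conjTranspose, Matrix.conjTranspose_mul, (hU k i).isHermitian.eq,
        (hx.psd k i).isHermitian.eq, Matrix.trace_mul_comm]
    exact Complex.conj_eq_iff_im.1 h1

end KKT

end

theorem proposition1 {M : ℕ} (S : ISACSystem M) (m : DuplexMode)
    (x : ℕ → Design M) (g : ℕ → Fin 2 → Fin 2 → ℝ) (hrun : S.IsSCARun m x g)
    (xlim : Design M) (hlim : Filter.Tendsto x Filter.atTop (nhds xlim)) :
    S.IsKKTPoint m xlim :=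
  ISACSystem.isKKTPoint_of_stationary (IsFeasible.of_tendsto hrun.feasible hlim)
    (fun hw k => hrun.sensInfo_limit_pos hlim hw k)
    fun _ hz => hrun.fderiv_objective_nonpos S hlim hz
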